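/- Let $k\ge 3$ be an integer. An instance of Max-$k$-Cut is an undirected graph $G$ with vertex set $V=\{1,\dots,n\}$, edge set $E$ and edge weights $w_{ij}\ge 0$; its optimum $\mathrm{OPT}_k(G)$ is the maximum, over all divisions of $V$ into at most $k$ disjoint sets, of the total weight of the edges whose endpoints lie in different sets. Its semidefinite relaxation is $$\max\ \sum_{ij\in E} w_{ij}\,\frac{k-1}{k}\,(1-v_i\cdot v_j)\quad\text{subject to}\quad v_i\in\mathbb{R}^n,\quad v_i\cdot v_i=1,\quad v_i\cdot v_j\ge -\frac1{k-1}\quad (i,j\in V).$$ Given a feasible solution $v=(v_i)_{i\in V}$ of the relaxation, *disc rounding* is the following randomized algorithm. For each $i$ and each angle $\phi$ let $v_i(\phi)=\cos\phi\,(v_i,\mathbf 0)+\sin\phi\,(\mathbf 0,v_i)\in\mathbb{R}^{2n}$. Draw $g\in\mathbb{R}^{2n}$ with independent $\mathcal N(0,1)$ coordinates, and let $\theta_i\in[0,2\pi)$ be the (almost surely unique) angle with $g\cdot v_i(\theta_i)=\max_{\phi} g\cdot v_i(\phi)$. Draw $\psi$ uniformly from $[0,2\pi)$, independently of $g$, and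 put vertex $i$ into the set number $c\in\{0,\dots,k-1\}$ if $\theta_i$ lies, modulo $2\pi$, in the arc $[\psi+\tfrac{2\pi c}{k},\,\psi+\tfrac{2\pi (c+1)}{k})$. Let $A_k(G,v)$ be the expected total weight of the edges whose endpoints are put into different sets. Set $$\phi_k=\frac{k-1}{k}+\frac{k}{4\pi^2}\left[\arccos^2\left(\frac{1}{k-1}\cos\frac{2\pi}{k}\right)-\arccos^2\left(\frac1{k-1}\right)\right].$$ **Theorem.** The worst-case approximation ratio of the algorithm that solves the relaxation optimally and applies disc rounding to the solution is exactly $\phi_k$: the minimum of $A_k(G,v)/\mathrm{OPT}_k(G)$, over all instances $G$ with $\mathrm{OPT}_k(G)>0$ and all optimal solutions $v$ of the relaxation of $G$, exists and equals $\phi_k$. Moreover, for every instance $G$ and every feasible solution $v$ of its relaxation, $$A_k(G,v)\ \ge\ \phi_k\sum_{ij\in E} w_{ij}\,\frac{k-1}{k}\,(1-v_i\cdot v_j).$$ -/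

import Mathlib

namespace MaxKCut

noncomputable section

/-- An undirected graph on `n` vertices with non-negative edge weights. -/
structure WeightedGraph (n : ℕ) where
  /-- the underlying simple graph -/
  graph : SimpleGraph (Fin n)
  /-- the weight `w i j` of the edge `ij` -/
  weight : Fin n → Fin n → ℝ
  weight_symm : ∀ i j, weight i j = weight j i
  weight_nonneg : ∀ i j, 0 ≤ weight i j

open Classical in
/-- The edges of `G`, each listed once, as the pair of its ends in increasing order. -/
def WeightedGraph.edges {n : ℕ} (G : WeightedGraph n) : Finset (Fin n × Fin n) :=
  Finset.univ.filter fun e => e.1 < e.2 ∧ G.graph.Adj e.1 e.2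

open Classical in
/-- Total weight of the edges whose ends get different labels. -/
def cutWeight {n : ℕ} (G : WeightedGraph n) {α : Type*} (label : Fin n → α) : ℝ :=
  ∑ e ∈ G.edges, if label e.1 ≠ label e.2 then G.weight e.1 e.2 else 0

/-- The optimum of Max-`k`-Cut on `G`: the maximum, over all divisions of the vertices into at
most `k` disjoint sets, of the weight of the edges whose ends lie in different sets. -/
def maxCut (k : ℕ) {n : ℕ} (G : WeightedGraph n) : ℝ :=
  ⨆ c : Fin n → Fin k, cutWeight G c

/-- Feasible solutions of the semidefinite relaxation of Max-`k`-Cut on `n` vertices: unit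
vectors in `ℝⁿ`, one for every vertex, with pairwise dot products at least `-1/(k-1)`. -/
def IsFeasible (k : ℕ) {n : ℕ} (v : Fin n → Fin n → ℝ) : Prop :=
  (∀ i, v i ⬝ᵥ v i = 1) ∧ ∀ i j, -1 / ((k : ℝ) - 1) ≤ v i ⬝ᵥ v j

/-- The objective function of the semidefinite relaxation. -/
def sdpValue (k : ℕ) {n : ℕ} (G : WeightedGraph n) (v : Fin n → Fin n → ℝ) : ℝ :=
  ∑ e ∈ G.edges, G.weight e.1 e.2 * (1 - v e.1 ⬝ᵥ v e.2) * (((k : ℝ) - 1) / k)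

/-- Optimal solutions of the semidefinite relaxation. -/
def IsOptimal (k : ℕ) {n : ℕ} (G : WeightedGraph n) (v : Fin n → Fin n → ℝ) : Prop :=
  IsFeasible k v ∧ ∀ u : Fin n → Fin n → ℝ, IsFeasible k u → sdpValue k G u ≤ sdpValue k G v

/-- The lifted vector `(x, 0)`; the index type `Fin n ⊕ Fin n` stands for `2n` coordinates. -/
def lift {n : ℕ} (x : Fin n → ℝ) : Fin n ⊕ Fin n → ℝ := Sum.elim x 0

/-- The lifted vector `(0, x)`. -/
def perp {n : ℕ} (x : Fin n → ℝ) : Fin n ⊕ Fin n → ℝ := Sum.elim 0 x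

/-- The point at angle `φ` of the (unit circle of the) disc spanned by `(x, 0)` and `(0, x)`. -/
def discPoint {n : ℕ} (x : Fin n → ℝ) (φ : ℝ) : Fin n ⊕ Fin n → ℝ :=
  Real.cos φ • lift x + Real.sin φ • perp x

/-- The angle in `[0, 2π)` of the projection of `g` onto the disc of `x`, that is, the polar
angle of `(g ⬝ᵥ (x, 0), g ⬝ᵥ (0, x))`. It is the angle that maximizes `g ⬝ᵥ discPoint x φ`:
see `discAngle_isMax` and `discAngle_unique`. -/
def discAngle {n : ℕ} (x : Fin n → ℝ) (g : Fin n ⊕ Fin n → ℝ) : ℝ :=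
  toIcoMod Real.two_pi_pos 0 (Complex.arg ⟨g ⬝ᵥ lift x, g ⬝ᵥ perp x⟩)

theorem discAngle_mem {n : ℕ} (x : Fin n → ℝ) (g : Fin n ⊕ Fin n → ℝ) :
    discAngle x g ∈ Set.Ico 0 (2 * Real.pi) := by
  have h := toIcoMod_mem_Ico Real.two_pi_pos 0 (Complex.arg ⟨g ⬝ᵥ lift x, g ⬝ᵥ perp x⟩)
  rwa [zero_add] at h

theorem dot_discPoint {n : ℕ} (x : Fin n → ℝ) (g : Fin n ⊕ Fin n → ℝ) (φ : ℝ) :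
    g ⬝ᵥ discPoint x φ =
      ‖(⟨g ⬝ᵥ lift x, g ⬝ᵥ perp x⟩ : ℂ)‖ * Real.cos (φ - discAngle x g) := by
  set z : ℂ := ⟨g ⬝ᵥ lift x, g ⬝ᵥ perp x⟩ with hz
  have hc : Real.cos (φ - discAngle x g) = Real.cos (φ - Complex.arg z) := by
    have h : φ - discAngle x g
        = φ - Complex.arg z + toIcoDiv Real.two_pi_pos 0 (Complex.arg z) * (2 * Real.pi) := by
      have := self_sub_toIcoDiv_zsmul Real.two_pi_pos 0 (Complex.arg z)
      rw [discAngle, ← hz, ← this, zsmul_eq_mul]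
      ring
    rw [h, Real.cos_add_int_mul_two_pi]
  have h1 : ‖z‖ * Real.cos (Complex.arg z) = g ⬝ᵥ lift x := Complex.norm_mul_cos_arg z
  have h2 : ‖z‖ * Real.sin (Complex.arg z) = g ⬝ᵥ perp x := Complex.norm_mul_sin_arg z
  rw [hc, Real.cos_sub, discPoint, dotProduct_add, dotProduct_smul, dotProduct_smul, ← h1, ← h2]
  simp only [smul_eq_mul]
  ring

theorem discAngle_isMax {n : ℕ} (x : Fin n → ℝ) (g : Fin n ⊕ Fin n → ℝ) (φ : ℝ) :
    g ⬝ᵥ discPoint x φ ≤ g ⬝ᵥ discPoint x (discAngle x g) := by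
  rw [dot_discPoint, dot_discPoint, sub_self, Real.cos_zero]
  exact mul_le_mul_of_nonneg_left (Real.cos_le_one _) (norm_nonneg _)

theorem discAngle_unique {n : ℕ} (x : Fin n → ℝ) (g : Fin n ⊕ Fin n → ℝ)
    (hg : g ⬝ᵥ lift x ≠ 0 ∨ g ⬝ᵥ perp x ≠ 0) (θ : ℝ) (hθ : θ ∈ Set.Ico 0 (2 * Real.pi))
    (hmax : ∀ φ, g ⬝ᵥ discPoint x φ ≤ g ⬝ᵥ discPoint x θ) : θ = discAngle x g := by
  have h := hmax (discAngle x g)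
  rw [dot_discPoint, dot_discPoint, sub_self, Real.cos_zero] at h
  have hpos : 0 < ‖(⟨g ⬝ᵥ lift x, g ⬝ᵥ perp x⟩ : ℂ)‖ := by
    rw [norm_pos_iff]
    intro h0
    have hre := congrArg Complex.re h0
    have him := congrArg Complex.im h0
    rcases hg with hg | hg
    · exact hg hre
    · exact hg him
  have hcos : Real.cos (θ - discAngle x g) = 1 :=
    le_antisymm (Real.cos_le_one _) (le_of_mul_le_mul_left h hpos)
  have hm := discAngle_mem x g
  have := (Real.cos_eq_one_iff_of_lt_of_lt (by linarith [hθ.1, hm.2])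
    (by linarith [hθ.2, hm.1])).1 hcos
  linarith

/-- The circle is divided into the `k` arcs
`[ψ + c * 2π/k, ψ + (c + 1) * 2π/k)`, `c = 0, …, k - 1`, modulo `2π`;
this is the number `c` of the arc that contains the angle `θ`. -/
def arc (k : ℕ) (ψ θ : ℝ) : ℕ :=
  ⌊toIcoMod Real.two_pi_pos 0 (θ - ψ) / (2 * Real.pi / k)⌋₊

theorem arc_lt {k : ℕ} (hk : 0 < k) (ψ θ : ℝ) : arc k ψ θ < k := by
  have h := toIcoMod_mem_Ico Real.two_pi_pos 0 (θ - ψ)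
  rw [zero_add] at h
  have hk' : (0 : ℝ) < k := Nat.cast_pos.2 hk
  have hp := Real.two_pi_pos
  rw [arc, Nat.floor_lt (div_nonneg h.1 (by positivity)), div_lt_iff₀ (by positivity)]
  have : (k : ℝ) * (2 * Real.pi / k) = 2 * Real.pi := by field_simp
  rw [this]
  exact h.2

/-- The law of the randomness `(g, ψ)` of the algorithm: `g` has `2n` independent standard normal
coordinates, and `ψ` is uniform on `[0, 2π)` and independent of `g`. -/
def roundingMeasure (n : ℕ) : MeasureTheory.Measure ((Fin n ⊕ Fin n → ℝ) × ℝ) :=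
  (MeasureTheory.Measure.pi fun _ : Fin n ⊕ Fin n => ProbabilityTheory.gaussianReal 0 1).prod
    (ProbabilityTheory.cond MeasureTheory.volume (Set.Ico 0 (2 * Real.pi)))

/-- The partition returned by the disc-rounding algorithm on the vectors `v`, for the random
choices `ω = (g, ψ)`. -/
def discRounding (k : ℕ) {n : ℕ} (v : Fin n → Fin n → ℝ) (ω : (Fin n ⊕ Fin n → ℝ) × ℝ)
    (i : Fin n) : ℕ :=
  arc k ω.2 (discAngle (v i) ω.1)

/-- The expected weight of the cut returned by the disc-rounding algorithm. -/
def expectedCut (k : ℕ) {n : ℕ} (G : WeightedGraph n) (v : Fin n → Fin n → ℝ) : ℝ :=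
  ∫ ω, cutWeight G (discRounding k v ω) ∂(roundingMeasure n)

/-- The approximation ratios of the algorithm on the individual instances: expected weight of the
returned cut over the optimum of Max-`k`-Cut, for every weighted graph with positive optimum and
every optimal solution of its semidefinite relaxation that is handed to the rounding. -/
def approximationRatios (k : ℕ) : Set ℝ :=
  {ρ | ∃ (n : ℕ) (G : WeightedGraph n) (v : Fin n → Fin n → ℝ),
    IsOptimal k G v ∧ 0 < maxCut k G ∧ ρ = expectedCut k G v / maxCut k G}

/-- The constant `φ_k`. -/
def phi (k : ℕ) : ℝ :=
  ((k : ℝ) - 1) / k + k / (4 * Real.pi ^ 2) *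
    (Real.arccos (1 / ((k : ℝ) - 1) * Real.cos (2 * Real.pi / k)) ^ 2
      - Real.arccos (1 / ((k : ℝ) - 1)) ^ 2)

end

end MaxKCut

/-! By linearity of expectation everything reduces to one pair of unit vectors with inner product
`ρ`. By rotation invariance of the Gaussian, their projections onto the two discs are distributed as
`z` and `ρz + sw`, where `z, w` are independent standard complex Gaussians and `ρ² + s² = 1`. The
separation probability is therefore a function of `ρ` alone, and the theorem is a statement about
that function.

Computing it: given angular distance `d`, the uniform `ψ` fails to separate the pair with
probability `max (1 - kd/2π) 0` (`integral_arc_eq_arc`). The signed angle `δ` between the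
projections has density `(1 - ρ²)/(2π) · q(ρ cos δ)`, where `2q` is the second derivative of
`arccos(-x)²` (`lintegral_cos_angle`). Twice this density has the second antiderivative `(δ² -
arccos(-ρ cos δ)²)/(2π)`. Since the failure probability is piecewise linear in `|δ|`, integrating by
parts leaves only values at `0` and `2π/k`, which gives `separationProb`
(`integral_tent_mul_angleDensity`).

Bounding it: `separationProb k` is concave on `[-1/(k-1), 1]`, with value `φ_k` at the left end and
`0` at the right. It lies above its chord, and the chord is `φ_k` times the contribution of the edge
to the relaxation (`phi_mul_le_separationProb`). Summing over the edges bounds the expected cut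
below by `φ_k` times the relaxation value, and regular simplices show that an optimal relaxation
value is at least the maximum cut. A single edge whose vectors have inner product `-1/(k-1)` attains
equality throughout. -/

namespace MaxKCut
noncomputable section

/-! ### Concavity of the separation probability in the inner product. -/

open Real

/-- Half of the second derivative of `x ↦ arccos (-x) ^ 2`. -/
def arccosSqDeriv (x : ℝ) : ℝ :=
  1 / (1 - x ^ 2) + x * arccos (-x) / √(1 - x ^ 2) ^ 3

theorem hasDerivAt_arccos_neg {x : ℝ} (h₁ : -1 < x) (h₂ : x < 1) :
    HasDerivAt (fun y => arccos (-y)) (1 / √(1 - x ^ 2)) x := by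
  have h := (hasDerivAt_arccos (x := -x) (by linarith) (by linarith)).comp x (hasDerivAt_neg x)
  refine h.congr_deriv ?_
  simp

theorem hasDerivAt_arccos_neg_sq {x : ℝ} (h₁ : -1 < x) (h₂ : x < 1) :
    HasDerivAt (fun y => arccos (-y) ^ 2) (2 * (arccos (-x) / √(1 - x ^ 2))) x := by
  refine ((hasDerivAt_arccos_neg h₁ h₂).pow 2).congr_deriv ?_
  simp
  ring

theorem hasDerivAt_arccos_neg_div {x : ℝ} (h₁ : -1 < x) (h₂ : x < 1) :
    HasDerivAt (fun y => arccos (-y) / √(1 - y ^ 2)) (arccosSqDeriv x) x := by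
  have hp : 0 < 1 - x ^ 2 := by nlinarith
  have hs : HasDerivAt (fun y : ℝ => √(1 - y ^ 2)) (-(2 * x) / (2 * √(1 - x ^ 2))) x := by
    have := ((hasDerivAt_pow 2 x).const_sub 1).sqrt hp.ne'
    simpa using this
  have hsp : 0 < √(1 - x ^ 2) := sqrt_pos.2 hp
  refine ((hasDerivAt_arccos_neg h₁ h₂).div hs hsp.ne').congr_deriv ?_
  rw [arccosSqDeriv]
  have h3 : √(1 - x ^ 2) ^ 2 = 1 - x ^ 2 := sq_sqrt hp.le
  rw [← h3]
  simp only [sqrt_sq hsp.le]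
  field_simp
  ring

theorem arccosSqDeriv_mono {x y : ℝ} (hx : 0 ≤ x) (hxy : x ≤ y) (hy : y < 1) :
    arccosSqDeriv x ≤ arccosSqDeriv y := by
  have h0 : 0 < 1 - y ^ 2 := by nlinarith
  have h1 : 1 - y ^ 2 ≤ 1 - x ^ 2 := by nlinarith
  have h2 : arccos (-x) ≤ arccos (-y) := arccos_le_arccos (by linarith)
  have h3 : 0 < √(1 - y ^ 2) := sqrt_pos.2 h0
  have h4 : √(1 - y ^ 2) ≤ √(1 - x ^ 2) := sqrt_le_sqrt h1
  have h5 := arccos_nonneg (-x)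
  have h6 := arccos_nonneg (-y)
  have h7 : 0 ≤ y := hx.trans hxy
  unfold arccosSqDeriv
  gcongr

theorem one_div_le_arccosSqDeriv {x : ℝ} (hx : 0 ≤ x) :
    1 / (1 - x ^ 2) ≤ arccosSqDeriv x := by
  have h1 := arccos_nonneg (-x)
  unfold arccosSqDeriv
  have : 0 ≤ x * arccos (-x) / √(1 - x ^ 2) ^ 3 := by positivity
  linarith

theorem arccosSqDeriv_le_one_div {x : ℝ} (hx : x ≤ 0) :
    arccosSqDeriv x ≤ 1 / (1 - x ^ 2) := by
  have h1 := arccos_nonneg (-x)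
  unfold arccosSqDeriv
  have : x * arccos (-x) / √(1 - x ^ 2) ^ 3 ≤ 0 :=
    div_nonpos_of_nonpos_of_nonneg (mul_nonpos_of_nonpos_of_nonneg hx h1) (by positivity)
  linarith

/-- For negative `x` the angle `θ = arccos(-x)` is acute with tangent `√(1 - x²)/(-x)`, so the claim
is `θ ≤ tan θ`. -/
theorem arccosSqDeriv_nonneg {x : ℝ} (h₁ : -1 < x) (h₂ : x < 1) : 0 ≤ arccosSqDeriv x := by
  have hp : 0 < 1 - x ^ 2 := by nlinarith
  rcases le_or_gt 0 x with h | h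
  · exact le_trans (by positivity) (one_div_le_arccosSqDeriv h)
  · have hs : 0 < √(1 - x ^ 2) := sqrt_pos.2 hp
    have hsq : √(1 - x ^ 2) ^ 2 = 1 - x ^ 2 := sq_sqrt hp.le
    have ht : arccos (-x) ≤ √(1 - x ^ 2) / -x := by
      have := le_tan (arccos_nonneg (-x)) (arccos_lt_pi_div_two.2 (by linarith))
      rwa [tan_arccos, neg_sq] at this
    rw [le_div_iff₀ (by linarith)] at ht
    have e : arccosSqDeriv x =
        (√(1 - x ^ 2) - arccos (-x) * -x) / √(1 - x ^ 2) ^ 3 := by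
      rw [arccosSqDeriv, ← hsq]
      simp only [sqrt_sq hs.le]
      field_simp
      ring
    rw [e]
    exact div_nonneg (by linarith) (by positivity)

/-- For `c ≥ 0` this is monotonicity on `[0, 1)`. For `c ≤ 0` the function `1/(1 - x²)` sits between
the two sides, because it bounds `arccosSqDeriv` from above at negative arguments and from below at
positive ones. -/
theorem sq_mul_arccosSqDeriv_le_of_nonneg {c x : ℝ} (hc₁ : -1 ≤ c) (hc₂ : c ≤ 1) (hx : 0 ≤ x)
    (hx1 : x < 1) : c ^ 2 * arccosSqDeriv (c * x) ≤ arccosSqDeriv x := by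
  have hc : c ^ 2 ≤ 1 := by nlinarith
  have hpos : 0 < 1 - x ^ 2 := by nlinarith
  have h1 : 1 / (1 - x ^ 2) ≤ arccosSqDeriv x := one_div_le_arccosSqDeriv hx
  have h0 : 0 ≤ arccosSqDeriv x := le_trans (by positivity) h1
  have key : arccosSqDeriv (c * x) ≤ arccosSqDeriv x := by
    rcases le_total 0 c with h | h
    · exact arccosSqDeriv_mono (by positivity) (by nlinarith) hx1
    · refine (arccosSqDeriv_le_one_div (mul_nonpos_of_nonpos_of_nonneg h hx)).trans
        (le_trans ?_ h1)
      have : (c * x) ^ 2 ≤ x ^ 2 := by rw [mul_pow]; nlinarith [sq_nonneg x]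
      gcongr
  nlinarith [sq_nonneg c]

theorem arccosSqDeriv_neg_eq {y : ℝ} (h₁ : -1 < y) (h₂ : y < 1) :
    y ^ 2 * arccosSqDeriv (-y) =
      (y / √(1 - y ^ 2)) ^ 2 - (y / √(1 - y ^ 2)) ^ 3 * arccos y := by
  have hp : 0 < 1 - y ^ 2 := by nlinarith
  have hsp : 0 < √(1 - y ^ 2) := sqrt_pos.2 hp
  have h3 : √(1 - y ^ 2) ^ 2 = 1 - y ^ 2 := sq_sqrt hp.le
  unfold arccosSqDeriv
  rw [neg_sq, neg_neg, ← h3]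
  simp only [sqrt_sq hsp.le]
  field_simp
  ring

/-- The concavity condition at `-y` with `c ≥ 0`, multiplied by `y²`, compares one function `z²
q(-z)` at `cy` and at `y`, so monotonicity suffices. With `u = z/√(1 - z²)` the function is `u² - u³
arccos z`, and for small `u` the square dominates. -/
theorem sq_mul_arccosSqDeriv_neg_mono {a y : ℝ} (ha : 0 ≤ a) (hay : a ≤ y) (hy : y ≤ 1 / 4) :
    a ^ 2 * arccosSqDeriv (-a) ≤ y ^ 2 * arccosSqDeriv (-y) := by
  rw [arccosSqDeriv_neg_eq (by linarith) (by linarith),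
    arccosSqDeriv_neg_eq (by linarith) (by linarith)]
  have hsy : 9 / 10 ≤ √(1 - y ^ 2) := by
    apply le_sqrt_of_sq_le
    nlinarith
  have hmono : √(1 - y ^ 2) ≤ √(1 - a ^ 2) := sqrt_le_sqrt (by nlinarith)
  have hus : a / √(1 - a ^ 2) ≤ y / √(1 - y ^ 2) := by
    have : 0 < √(1 - y ^ 2) := by linarith
    have : 0 ≤ y := ha.trans hay
    gcongr
  have hu0 : 0 ≤ a / √(1 - a ^ 2) := by positivity
  have huy : y / √(1 - y ^ 2) ≤ 0.3 := by
    rw [div_le_iff₀ (by linarith)]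
    linarith
  have hB : arccos y ≤ arccos a := arccos_le_arccos hay
  have hB0 : 0 ≤ arccos y := arccos_nonneg y
  have hB2 : arccos a ≤ 1.6 := by
    have := arccos_le_pi_div_two.2 ha
    linarith [pi_lt_d2]
  set u := a / √(1 - a ^ 2)
  set w := y / √(1 - y ^ 2)
  have hw0 : 0 ≤ w := hu0.trans hus
  have h1 : w ^ 3 * arccos y ≤ w ^ 3 * arccos a := by gcongr
  have h2 : (w ^ 3 - u ^ 3) * arccos a ≤ (w ^ 3 - u ^ 3) * 1.6 := by
    have : u ^ 3 ≤ w ^ 3 := by gcongr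
    gcongr
  have h3 : (w ^ 3 - u ^ 3) * 1.6 ≤ w ^ 2 - u ^ 2 := by
    -- Since `u, w ≤ 0.3`, one has `w² + uw + u² ≤ (w + u)² ≤ 0.6 (w + u)`, and `1.6 · 0.6 < 1`.
    have : 0 ≤ (w - u) * ((w + u) - 1.6 * (w ^ 2 + u * w + u ^ 2)) := by
      apply mul_nonneg (by linarith)
      nlinarith
    nlinarith
  nlinarith

/-- The case `k = 3`, where the cosine is `-1/2`. The constant `0.42` separates the sides: the left
is at most a quarter of the value of `arccosSqDeriv` at `1/4`, and the right is bounded below using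
`√(1 - y²) ≥ 0.866` and `arccos y ≤ 1.571 - y`. -/
theorem arccosSqDeriv_quarter_le {y : ℝ} (hy : 0 ≤ y) (hy' : y ≤ 1 / 2) :
    (-(1 / 2) : ℝ) ^ 2 * arccosSqDeriv (-(1 / 2) * -y) ≤ arccosSqDeriv (-y) := by
  have hu : (-(1 / 2) : ℝ) ^ 2 * arccosSqDeriv (-(1 / 2) * -y) ≤ 0.42 := by
    have h1 : arccosSqDeriv (-(1 / 2) * -y) ≤ arccosSqDeriv (1 / 4) :=
      arccosSqDeriv_mono (by linarith) (by linarith) (by norm_num)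
    have h2 : arccosSqDeriv (1 / 4) ≤ 1.68 := by
      unfold arccosSqDeriv
      have h3 : arccos (-(1 / 4)) ≤ 2.1 := by
        have h4 : arccos (-(1 / 4)) ≤ arccos (-(1 / 2)) := arccos_le_arccos (by norm_num)
        have h5 : arccos (1 / 2) = π / 3 := by
          rw [← cos_pi_div_three, arccos_cos (by positivity) (by linarith [pi_pos])]
        rw [arccos_neg (1 / 2), h5] at h4
        linarith [pi_lt_d2]
      have h6 : 0.968 ≤ √(1 - (1 / 4) ^ 2) := by
        apply le_sqrt_of_sq_le
        norm_num
      have h7 : (0.9 : ℝ) ≤ √(1 - (1 / 4) ^ 2) ^ 3 :=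
        le_trans (by norm_num) (pow_le_pow_left₀ (by norm_num) h6 3)
      have h8 : 1 / 4 * arccos (-(1 / 4)) / √(1 - (1 / 4) ^ 2) ^ 3 ≤ 0.6 := by
        rw [div_le_iff₀ (by linarith)]
        nlinarith
      norm_num at h8 ⊢
      linarith
    linarith
  refine hu.trans ?_
  have hp : 0 < 1 - y ^ 2 := by nlinarith
  have hs : 0.866 ≤ √(1 - y ^ 2) := by
    apply le_sqrt_of_sq_le
    nlinarith
  have h3 : √(1 - y ^ 2) ^ 2 = 1 - y ^ 2 := sq_sqrt hp.le
  have hA : arccos y ≤ 1.571 - y := by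
    have : y ≤ arcsin y := by
      have := sin_le hy
      rw [le_arcsin_iff_sin_le ⟨by linarith [pi_gt_three], by linarith [pi_gt_three]⟩
        ⟨by linarith, by linarith⟩]
      exact this
    rw [arccos]
    linarith [pi_lt_d6]
  unfold arccosSqDeriv
  rw [neg_neg, neg_sq, ← h3]
  have hs0 : 0 < √(1 - y ^ 2) := by linarith
  simp only [sqrt_sq hs0.le]
  have key : 0.42 * √(1 - y ^ 2) ^ 3 ≤ √(1 - y ^ 2) - y * arccos y := by
    have h4 : y * arccos y ≤ y * (1.571 - y) := by gcongr
    have h5 : √(1 - y ^ 2) ^ 3 = √(1 - y ^ 2) * (1 - y ^ 2) := by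
      rw [pow_succ', h3]
    rw [h5]
    -- After these two estimates a quadratic in `y` with negative discriminant remains; `0.576` is
    -- approximately its minimizer.
    nlinarith [sq_nonneg (y - 0.576), mul_nonneg (sub_nonneg.2 hs) (sq_nonneg y)]
  have : 1 / √(1 - y ^ 2) ^ 2 + -y * arccos y / √(1 - y ^ 2) ^ 3
      = (√(1 - y ^ 2) - y * arccos y) / √(1 - y ^ 2) ^ 3 := by
    field_simp
    ring
  rw [this, le_div_iff₀ (by positivity)]
  exact key

/-- This is the concavity condition. For negative `x`, feasibility confines `x` to `(-1/(k-1), 0]`: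
`k = 3` is numerical, for `k = 4` the cosine vanishes, and for `k ≥ 5` the cosine is nonnegative and
`|x| ≤ 1/4`. -/
theorem cos_two_pi_div_sq_mul_arccosSqDeriv_le {k : ℕ} (hk : 3 ≤ k) {x : ℝ}
    (hx : -1 / ((k : ℝ) - 1) < x) (hx1 : x < 1) :
    cos (2 * π / k) ^ 2 * arccosSqDeriv (cos (2 * π / k) * x) ≤ arccosSqDeriv x := by
  rcases le_total 0 x with h0 | h0
  · exact sq_mul_arccosSqDeriv_le_of_nonneg (neg_one_le_cos _) (cos_le_one _) h0 hx1
  have hk3 : (3 : ℝ) ≤ k := by exact_mod_cast hk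
  rw [div_lt_iff₀ (by linarith)] at hx
  obtain ⟨y, rfl⟩ : ∃ y, x = -y := ⟨-x, by ring⟩
  have hy : 0 ≤ y := by linarith
  rcases (by omega : k = 3 ∨ k = 4 ∨ 5 ≤ k) with rfl | rfl | h5
  · have hc : cos (2 * π / (3 : ℕ)) = -(1 / 2) := by
      rw [show 2 * π / (3 : ℕ) = π - π / 3 by push_cast; ring, cos_pi_sub, cos_pi_div_three]
    rw [hc]
    push_cast at hx
    exact arccosSqDeriv_quarter_le hy (by linarith)
  · have hc : cos (2 * π / (4 : ℕ)) = 0 := by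
      rw [show 2 * π / (4 : ℕ) = π / 2 by push_cast; ring, cos_pi_div_two]
    rw [hc]
    push_cast at hx
    simpa using arccosSqDeriv_nonneg (x := -y) (by linarith) (by linarith)
  · have hk5 : (5 : ℝ) ≤ k := by exact_mod_cast h5
    have hc : 0 ≤ cos (2 * π / k) := by
      apply cos_nonneg_of_mem_Icc
      constructor
      · have : 0 ≤ 2 * π / k := by positivity
        linarith [pi_pos]
      · rw [div_le_iff₀ (by linarith)]
        nlinarith [pi_pos]
    have hc1 := cos_le_one (2 * π / k)
    set c := cos (2 * π / k)
    have hy4 : y ≤ 1 / 4 := by nlinarith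
    -- The factor `y²` can be cancelled only for `y > 0`; at `0` the claim is `c² ≤ 1`.
    rcases hy.eq_or_lt with rfl | hpos
    · simp only [neg_zero, mul_zero, arccosSqDeriv]
      simp
      exact abs_le.2 ⟨by linarith, hc1⟩
    · have := sq_mul_arccosSqDeriv_neg_mono (a := c * y) (y := y) (by positivity)
        (by nlinarith) hy4
      have h6 : y ^ 2 * (c ^ 2 * arccosSqDeriv (c * -y)) ≤ y ^ 2 * arccosSqDeriv (-y) := by
        rw [mul_neg]
        calc _ = (c * y) ^ 2 * arccosSqDeriv (-(c * y)) := by ring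
          _ ≤ _ := this
      exact le_of_mul_le_mul_left h6 (by positivity)

/-- The probability that disc rounding separates two unit vectors with inner product `ρ`. -/
def separationProb (k : ℕ) (ρ : ℝ) : ℝ :=
  ((k : ℝ) - 1) / k + k / (4 * π ^ 2) *
    (arccos (-(cos (2 * π / k) * ρ)) ^ 2 - arccos (-ρ) ^ 2)

theorem separationProb_eq_phi (k : ℕ) : separationProb k (-1 / ((k : ℝ) - 1)) = phi k := by
  rw [separationProb, phi, show -(cos (2 * π / k) * (-1 / ((k : ℝ) - 1))) =
    1 / ((k : ℝ) - 1) * cos (2 * π / k) by ring, show -(-1 / ((k : ℝ) - 1)) =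
    1 / ((k : ℝ) - 1) by ring]

theorem separationProb_one {k : ℕ} (hk : 3 ≤ k) : separationProb k 1 = 0 := by
  have hk3 : (3 : ℝ) ≤ k := by exact_mod_cast hk
  have hle : 2 * π / k ≤ π := by
    rw [div_le_iff₀ (by linarith)]
    nlinarith [pi_pos]
  rw [separationProb, mul_one, arccos_neg, arccos_cos (by positivity) hle, arccos_neg, arccos_one]
  have := pi_pos
  field_simp
  ring

theorem concaveOn_separationProb {k : ℕ} (hk : 3 ≤ k) :
    ConcaveOn ℝ (Set.Icc (-1 / ((k : ℝ) - 1)) 1) (separationProb k) := by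
  have hk3 : (3 : ℝ) ≤ k := by exact_mod_cast hk
  have hr : -1 < -1 / ((k : ℝ) - 1) := by
    rw [lt_div_iff₀ (by linarith)]
    linarith
  set c := cos (2 * π / k) with hc
  have hcx : ∀ x ∈ Set.Ioo (-1 / ((k : ℝ) - 1)) 1, -1 < c * x ∧ c * x < 1 := by
    intro x hx
    rw [← abs_lt, abs_mul]
    have h1 : |c| ≤ 1 := abs_cos_le_one _
    have h2 : |x| < 1 := abs_lt.2 ⟨by linarith [hx.1], hx.2⟩
    nlinarith [abs_nonneg x, abs_nonneg c]
  refine concaveOn_of_hasDerivWithinAt2_nonpos (convex_Icc _ _)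
    (f' := fun x => k / (4 * π ^ 2) * (2 * (arccos (-(c * x)) / √(1 - (c * x) ^ 2)) * c
      - 2 * (arccos (-x) / √(1 - x ^ 2))))
    (f'' := fun x => k / (4 * π ^ 2) * (2 * (arccosSqDeriv (c * x) * c) * c
      - 2 * arccosSqDeriv x)) ?_ ?_ ?_ ?_
  · apply Continuous.continuousOn
    unfold separationProb
    fun_prop
  · intro x hx
    rw [interior_Icc] at hx ⊢
    apply HasDerivAt.hasDerivWithinAt
    have hm : HasDerivAt (fun y => c * y) c x := by simpa using (hasDerivAt_id x).const_mul c
    have h1 := (hasDerivAt_arccos_neg_sq (hcx x hx).1 (hcx x hx).2).comp x hm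
    have h2 := hasDerivAt_arccos_neg_sq (x := x) (by linarith [hx.1]) hx.2
    exact ((h1.sub h2).const_mul _).const_add _
  · intro x hx
    rw [interior_Icc] at hx ⊢
    apply HasDerivAt.hasDerivWithinAt
    have hm : HasDerivAt (fun y => c * y) c x := by simpa using (hasDerivAt_id x).const_mul c
    have h1 := (hasDerivAt_arccos_neg_div (hcx x hx).1 (hcx x hx).2).comp x hm
    have h2 := hasDerivAt_arccos_neg_div (x := x) (by linarith [hx.1]) hx.2
    exact (((h1.const_mul 2).mul_const c).sub (h2.const_mul 2)).const_mul _
  · intro x hx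
    rw [interior_Icc] at hx
    have := cos_two_pi_div_sq_mul_arccosSqDeriv_le hk hx.1 hx.2
    rw [← hc] at this
    apply mul_nonpos_of_nonneg_of_nonpos (by positivity)
    nlinarith

theorem phi_mul_le_separationProb {k : ℕ} (hk : 3 ≤ k) {ρ : ℝ}
    (h₁ : -1 / ((k : ℝ) - 1) ≤ ρ) (h₂ : ρ ≤ 1) :
    phi k * ((1 - ρ) * (((k : ℝ) - 1) / k)) ≤ separationProb k ρ := by
  have hk3 : (3 : ℝ) ≤ k := by exact_mod_cast hk
  have hr : -1 / ((k : ℝ) - 1) ≤ 1 := by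
    rw [div_le_iff₀ (by linarith)]
    linarith
  have ht0 : 0 ≤ (1 - ρ) * (((k : ℝ) - 1) / k) :=
    mul_nonneg (by linarith) (div_nonneg (by linarith) (by linarith))
  -- The weight of the left endpoint in this convex combination is exactly the contribution of a
  -- unit-weight edge to the relaxation.
  have hcomb : (1 - ρ) * (((k : ℝ) - 1) / k) * (-1 / ((k : ℝ) - 1)) +
      (1 - (1 - ρ) * (((k : ℝ) - 1) / k)) * 1 = ρ := by
    have : (k : ℝ) - 1 ≠ 0 := by linarith
    field_simp
    ring
  have ht1 : 0 ≤ 1 - (1 - ρ) * (((k : ℝ) - 1) / k) := by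
    rw [div_le_iff₀ (by linarith)] at h₁
    rw [sub_nonneg, ← mul_div_assoc, div_le_one (by linarith)]
    linarith
  have h := (concaveOn_separationProb hk).2 (Set.left_mem_Icc.2 hr) (Set.right_mem_Icc.2 hr)
    ht0 ht1 (by ring)
  simp only [smul_eq_mul] at h
  rw [hcomb, separationProb_eq_phi, separationProb_one hk] at h
  linarith

end
end MaxKCut

/-! ### Averaging over the random offset of the arcs. -/

namespace MaxKCut
noncomputable section

open Real MeasureTheory

theorem arc_eq_arc_zero (k : ℕ) (ψ θ : ℝ) : arc k ψ θ = arc k 0 (θ - ψ) := by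
  simp [arc]

theorem arc_zero_periodic (k : ℕ) : Function.Periodic (arc k 0) (2 * π) := by
  intro θ
  simp only [arc, sub_zero, toIcoMod_add_right]

theorem measurable_toIcoMod_two_pi : Measurable (toIcoMod two_pi_pos 0) := by
  have : toIcoMod two_pi_pos 0 = fun b => Int.fract (b / (2 * π)) * (2 * π) :=
    funext fun b => toIcoMod_eq_fract_mul _ b
  rw [this]
  exact (measurable_id.div_const _).fract.mul_const _

theorem measurable_arc (k : ℕ) {α : Type*} [MeasurableSpace α] {f g : α → ℝ} (hf : Measurable f)
    (hg : Measurable g) : Measurable fun a => arc k (f a) (g a) := by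
  unfold arc
  exact ((measurable_toIcoMod_two_pi.comp (hg.sub hf)).div_const _).nat_floor

/-- The two points share an arc exactly when the offset of `x` inside its arc, plus `d`, stays below
the arc length. -/
theorem arc_zero_eq_arc_zero_add_iff {k : ℕ} (hk : 3 ≤ k) {x d : ℝ} (hx : x ∈ Set.Ico 0 (2 * π))
    (hd : 0 ≤ d) (hdπ : d ≤ π) :
    arc k 0 x = arc k 0 (x + d) ↔
      Int.fract (x / (2 * π / k)) < (2 * π / k - d) / (2 * π / k) := by
  have hk3 : (3 : ℝ) ≤ k := by exact_mod_cast hk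
  have hπ := pi_pos
  have hh : 0 < 2 * π / k := by positivity
  have hkh : 2 * π = k * (2 * π / k) := by field_simp
  set h := 2 * π / k with hdef
  have ha : 0 ≤ x / h := div_nonneg hx.1 hh.le
  have hak : x / h < k := by rw [div_lt_iff₀ hh, ← hkh]; exact hx.2
  have hb : 0 ≤ d / h := div_nonneg hd hh.le
  have hbk : d / h ≤ k / 2 := by rw [div_le_iff₀ hh]; linarith
  have hrhs : (h - d) / h = 1 - d / h := by field_simp
  have e1 : (arc k 0 x : ℤ) = ⌊x / h⌋ := by
    rw [arc, sub_zero, (toIcoMod_eq_self two_pi_pos).2 (by simpa using hx), ← hdef,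
      Int.natCast_floor_eq_floor ha]
  rw [← Int.natCast_inj, e1, hrhs]
  have hfl := Int.floor_le (x / h)
  have hfl' := Int.lt_floor_add_one (x / h)
  have hfr : Int.fract (x / h) = x / h - ⌊x / h⌋ := rfl
  have hflk : (⌊x / h⌋ : ℝ) ≤ k - 1 := by
    have : ⌊x / h⌋ < (k : ℤ) := Int.floor_lt.2 (by exact_mod_cast hak)
    have : ⌊x / h⌋ ≤ (k : ℤ) - 1 := by omega
    exact_mod_cast this
  rcases lt_or_ge (x + d) (2 * π) with hlt | hge
  · have e2 : (arc k 0 (x + d) : ℤ) = ⌊x / h + d / h⌋ := by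
      rw [arc, sub_zero, (toIcoMod_eq_self two_pi_pos).2
        ⟨by linarith [hx.1], by linarith⟩, ← hdef, add_div,
        Int.natCast_floor_eq_floor (by positivity)]
    rw [e2, eq_comm, Int.floor_eq_iff, hfr]
    constructor
    · rintro ⟨_, h2⟩
      linarith
    · intro h1
      exact ⟨by linarith, by linarith⟩
  -- After wrapping past `2π` both sides are false: a shift by at most `k/2` arcs cannot lead back
  -- to the starting arc, and crossing `2π` already crosses an arc boundary.
  · have e2 : (arc k 0 (x + d) : ℤ) = ⌊x / h + d / h - k⌋ := by
      have hper : arc k 0 (x + d) = arc k 0 (x + d - 2 * π) :=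
        ((arc_zero_periodic k).sub_eq _).symm
      have hdiv : (x + d - 2 * π) / h = x / h + d / h - k := by
        rw [sub_div, add_div, hkh, mul_div_cancel_right₀ _ hh.ne']
      rw [hper, arc, sub_zero, (toIcoMod_eq_self two_pi_pos).2
        ⟨by linarith [hx.1], by linarith [hx.2]⟩, ← hdef,
        Int.natCast_floor_eq_floor (div_nonneg (by linarith) hh.le), hdiv]
    have hge' : k ≤ x / h + d / h := by
      rw [← add_div, le_div_iff₀ hh, ← hkh]
      exact hge
    rw [e2, hfr]
    constructor
    · intro h1
      have := Int.floor_le (x / h + d / h - k)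
      rw [← h1] at this
      linarith
    · intro h1
      linarith

/-- The tent function: the probability that a random sector of angle `2π/k` does not separate
two points at angular distance `x`. -/
def tent (k : ℕ) (x : ℝ) : ℝ := max (1 - x / (2 * π / k)) 0

/-- The indicator is periodic with period one arc, so the integral is `k` times that over a single
arc, which is `max (2π/k - d) 0`. -/
theorem integral_arc_eq_arc_add {k : ℕ} (hk : 3 ≤ k) {d : ℝ} (hd : 0 ≤ d) (hdπ : d ≤ π) :
    ∫ x in (0)..(2 * π), (if arc k 0 x = arc k 0 (x + d) then (1 : ℝ) else 0) =
      2 * π * tent k d := by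
  have hπ := pi_pos
  have hk3 : (3 : ℝ) ≤ k := by exact_mod_cast hk
  have hh : 0 < 2 * π / k := by positivity
  have hkh : 2 * π = 0 + (k : ℤ) • (2 * π / k) := by
    rw [zsmul_eq_mul]
    push_cast
    field_simp
    ring
  unfold tent
  set h := 2 * π / k with hdef
  set g : ℝ → ℝ := fun x => if Int.fract (x / h) < (h - d) / h then 1 else 0 with hg
  have hmeas : MeasurableSet {x : ℝ | Int.fract (x / h) < (h - d) / h} :=
    measurableSet_lt (measurable_id.div_const _).fract measurable_const
  have hgm : Measurable g := Measurable.ite hmeas measurable_const measurable_const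
  have hgi : ∀ a b, IntervalIntegrable g volume a b := by
    intro a b
    refine (intervalIntegrable_const (c := (1 : ℝ))).mono_fun hgm.aestronglyMeasurable
      (ae_of_all _ fun x => ?_)
    simp only [hg]
    split_ifs <;> simp
  have hgp : Function.Periodic g h := by
    intro x
    simp only [hg, add_div, div_self hh.ne', Int.fract_add_one]
  have e1 : ∫ x in (0)..(2 * π), (if arc k 0 x = arc k 0 (x + d) then (1 : ℝ) else 0) =
      ∫ x in (0)..(2 * π), g x := by
    rw [intervalIntegral.integral_of_le (by positivity),
      intervalIntegral.integral_of_le (by positivity), integral_Ioc_eq_integral_Ioo,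
      integral_Ioc_eq_integral_Ioo]
    refine setIntegral_congr_fun measurableSet_Ioo fun x hx => ?_
    simp only [hg, arc_zero_eq_arc_zero_add_iff hk (Set.Ioo_subset_Ico_self hx) hd hdπ]
    rfl
  have e2 : ∫ x in (0)..h, g x = max (h - d) 0 := by
    rw [intervalIntegral.integral_of_le hh.le, integral_Ioc_eq_integral_Ioo]
    have : ∀ x ∈ Set.Ioo 0 h, g x = (Set.Ioo 0 (h - d)).indicator 1 x := by
      intro x hx
      have hfr : Int.fract (x / h) = x / h :=
        Int.fract_eq_self.2 ⟨div_nonneg hx.1.le hh.le, (div_lt_one hh).2 hx.2⟩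
      simp only [hg, hfr, div_lt_div_iff_of_pos_right hh, Set.indicator, Set.mem_Ioo, hx.1,
        true_and, Pi.one_apply]
    rw [setIntegral_congr_fun measurableSet_Ioo this, setIntegral_indicator measurableSet_Ioo,
      Set.inter_eq_right.2 (Set.Ioo_subset_Ioo_right (by linarith))]
    simp [Measure.real, ENNReal.toReal_ofReal']
  rw [e1, hkh, hgp.intervalIntegral_add_zsmul_eq (k : ℤ) 0 hgi, zero_add, e2]
  rcases le_total h d with hle | hle
  · rw [max_eq_right (by linarith), max_eq_right (by rw [sub_nonpos, one_le_div hh]; exact hle)]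
    simp
  · rw [max_eq_left (by linarith), max_eq_left (by rw [sub_nonneg, div_le_one hh]; exact hle)]
    simp only [zsmul_eq_mul]
    field_simp
    ring

/-- Modulo `2π`, `β - α` is plus or minus the angular distance. By symmetry the smaller of the two
angles may be taken as base point, and `2π`-periodicity absorbs the shift and reflection of `ψ`. -/
theorem integral_arc_eq_arc {k : ℕ} (hk : 3 ≤ k) (α β : ℝ) :
    ∫ ψ in (0)..(2 * π), (if arc k ψ α = arc k ψ β then (1 : ℝ) else 0) =
      2 * π * tent k (arccos (cos (β - α))) := by
  have hd : 0 ≤ arccos (cos (β - α)) := arccos_nonneg _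
  have hdπ : arccos (cos (β - α)) ≤ π := arccos_le_pi _
  have hcos : cos (arccos (cos (β - α))) = cos (β - α) :=
    cos_arccos (neg_one_le_cos _) (cos_le_one _)
  rw [← integral_arc_eq_arc_add hk hd hdπ]
  set d := arccos (cos (β - α))
  have shift : ∀ a : ℝ,
      ∫ ψ in (0)..(2 * π), (if arc k 0 (a - ψ) = arc k 0 (a - ψ + d) then (1 : ℝ) else 0) =
      ∫ x in (0)..(2 * π), (if arc k 0 x = arc k 0 (x + d) then (1 : ℝ) else 0) := by
    intro a
    rw [intervalIntegral.integral_comp_sub_left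
      (fun x => if arc k 0 x = arc k 0 (x + d) then (1 : ℝ) else 0)]
    have hp : Function.Periodic
        (fun x => if arc k 0 x = arc k 0 (x + d) then (1 : ℝ) else 0) (2 * π) := by
      intro x
      simp only [add_right_comm x (2 * π) d, arc_zero_periodic k _]
    have := hp.intervalIntegral_add_eq (a - 2 * π) 0
    simpa using this
  have per : ∀ (m : ℤ) (x : ℝ), arc k 0 (x + 2 * m * π) = arc k 0 x := by
    intro m x
    have := (arc_zero_periodic k).int_mul m x
    rw [← this]
    ring_nf
  simp only [arc_eq_arc_zero k _ α, arc_eq_arc_zero k _ β]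
  obtain ⟨m, hm | hm⟩ := cos_eq_cos_iff.1 hcos
  · rw [← shift α]
    have : ∀ ψ, arc k 0 (β - ψ) = arc k 0 (α - ψ + d) := by
      intro ψ
      rw [← per m (α - ψ + d)]
      congr 1
      linarith
    simp only [this]
  · rw [← shift β]
    have : ∀ ψ, arc k 0 (α - ψ) = arc k 0 (β - ψ + d) := by
      intro ψ
      rw [← per (-m) (β - ψ + d)]
      congr 1
      push_cast
      linarith
    simp only [this, eq_comm]

instance isProbabilityMeasure_cond_Ico :
    IsProbabilityMeasure (ProbabilityTheory.cond volume (Set.Ico 0 (2 * π))) :=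
  ProbabilityTheory.cond_isProbabilityMeasure_of_finite (by simp [pi_pos])
    (by rw [Real.volume_Ico]; exact ENNReal.ofReal_ne_top)

theorem integral_cond_arc_ne {k : ℕ} (hk : 3 ≤ k) (α β : ℝ) :
    ∫ ψ, (if arc k ψ α ≠ arc k ψ β then (1 : ℝ) else 0)
        ∂(ProbabilityTheory.cond volume (Set.Ico 0 (2 * π))) =
      1 - tent k (arccos (cos (β - α))) := by
  have hvol : volume (Set.Ico 0 (2 * π)) = ENNReal.ofReal (2 * π) := by simp
  have hs : MeasurableSet {ψ : ℝ | arc k ψ α = arc k ψ β} :=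
    measurableSet_eq_fun (measurable_arc k measurable_id measurable_const)
      (measurable_arc k measurable_id measurable_const)
  have hm : Measurable fun ψ => if arc k ψ α = arc k ψ β then (1 : ℝ) else 0 :=
    Measurable.ite hs measurable_const measurable_const
  have hi : Integrable (fun ψ => if arc k ψ α = arc k ψ β then (1 : ℝ) else 0)
      (ProbabilityTheory.cond volume (Set.Ico 0 (2 * π))) :=
    Integrable.of_bound hm.aestronglyMeasurable 1 (ae_of_all _ fun ψ => by split_ifs <;> simp)
  have h1 : ∀ ψ, (if arc k ψ α ≠ arc k ψ β then (1 : ℝ) else 0) =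
      1 - if arc k ψ α = arc k ψ β then (1 : ℝ) else 0 := by
    intro ψ
    by_cases h : arc k ψ α = arc k ψ β <;> simp [h]
  simp only [h1]
  rw [integral_sub (integrable_const _) hi]
  congr 1
  · simp
  rw [ProbabilityTheory.cond, integral_smul_measure, hvol, integral_Ico_eq_integral_Ioc,
    ← intervalIntegral.integral_of_le (by positivity), integral_arc_eq_arc hk]
  have := pi_pos
  simp only [ENNReal.toReal_inv, ENNReal.toReal_ofReal two_pi_pos.le, smul_eq_mul]
  field_simp

end
end MaxKCut

/-! ### Complex Gaussians and the disc projections. -/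

namespace MaxKCut
noncomputable section

open MeasureTheory ProbabilityTheory
open scoped Real ENNReal

/-- The standard Gaussian measure on `ℂ`: real and imaginary parts are independent standard
normal variables. -/
def complexGaussian : Measure ℂ :=
  ((gaussianReal 0 1).prod (gaussianReal 0 1)).map Complex.measurableEquivRealProd.symm

instance : IsProbabilityMeasure complexGaussian :=
  Measure.isProbabilityMeasure_map Complex.measurableEquivRealProd.symm.measurable.aemeasurable

/-- The density of the standard Gaussian measure on `ℂ`. -/
def complexGaussianPDF (z : ℂ) : ℝ≥0∞ :=
  ENNReal.ofReal ((2 * π)⁻¹ * Real.exp (-‖z‖ ^ 2 / 2))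

theorem measurable_complexGaussianPDF : Measurable complexGaussianPDF := by
  unfold complexGaussianPDF
  fun_prop

theorem complexGaussian_eq_withDensity :
    complexGaussian = volume.withDensity complexGaussianPDF := by
  refine Measure.ext_of_lintegral _ fun f hf => ?_
  rw [complexGaussian, lintegral_map hf Complex.measurableEquivRealProd.symm.measurable,
    gaussianReal_of_var_ne_zero 0 one_ne_zero,
    prod_withDensity (measurable_gaussianPDF 0 1) (measurable_gaussianPDF 0 1),
    lintegral_withDensity_eq_lintegral_mul _ (by fun_prop) (by fun_prop),
    lintegral_withDensity_eq_lintegral_mul _ measurable_complexGaussianPDF hf,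
    ← Complex.volume_preserving_equiv_real_prod.symm.lintegral_comp
      (measurable_complexGaussianPDF.mul hf)]
  refine lintegral_congr fun p => ?_
  simp only [Pi.mul_apply]
  congr 1
  rw [gaussianPDF, gaussianPDF, ← ENNReal.ofReal_mul (gaussianPDFReal_nonneg _ _ _),
    complexGaussianPDF]
  congr 1
  have hn : ‖Complex.measurableEquivRealProd.symm p‖ ^ 2 = p.1 ^ 2 + p.2 ^ 2 := by
    rw [Complex.sq_norm, Complex.normSq_apply]
    simp only [Complex.measurableEquivRealProd_symm_apply]
    ring
  rw [gaussianPDFReal, gaussianPDFReal, hn]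
  simp only [NNReal.coe_one, mul_one, sub_zero]
  rw [mul_mul_mul_comm, ← mul_inv, Real.mul_self_sqrt (by positivity), ← Real.exp_add]
  ring_nf

theorem integral_exp_dotProduct_pi_gaussianReal {κ : Type*} [Fintype κ] (c : κ → ℝ) :
    ∫ g : κ → ℝ, Complex.exp ((∑ i, g i * c i : ℝ) * Complex.I)
      ∂(Measure.pi fun _ => gaussianReal 0 1) = Complex.exp (-((∑ i, c i ^ 2 : ℝ) : ℂ) / 2) := by
  simp_rw [Complex.ofReal_sum, Finset.sum_mul, Complex.exp_sum]
  rw [integral_fintype_prod_eq_prod (f := fun i x => Complex.exp (((x * c i : ℝ) : ℂ) * Complex.I))]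
  simp_rw [mul_comm _ (c _), Complex.ofReal_mul, ← charFun_apply_real, charFun_gaussianReal]
  rw [← Complex.exp_sum]
  simp [Finset.sum_div, neg_div]

theorem charFunDual_complexGaussian (L : StrongDual ℝ ℂ) :
    charFunDual complexGaussian L =
      Complex.exp (-((L 1 ^ 2 + L Complex.I ^ 2 : ℝ) : ℂ) / 2) := by
  rw [charFunDual_apply, complexGaussian, integral_map_equiv]
  have hL : ∀ p : ℝ × ℝ, L (Complex.measurableEquivRealProd.symm p) =
      L 1 * p.1 + L Complex.I * p.2 := by
    intro p
    have : Complex.measurableEquivRealProd.symm p = p.1 • (1 : ℂ) + p.2 • Complex.I := by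
      rw [Complex.measurableEquivRealProd_symm_apply]
      apply Complex.ext <;> simp
    rw [this, map_add, map_smul, map_smul]
    simp [mul_comm]
  simp_rw [hL, Complex.ofReal_add, add_mul, Complex.exp_add]
  rw [integral_prod_mul (fun x : ℝ => Complex.exp (((L 1 * x : ℝ) : ℂ) * Complex.I))
    (fun x : ℝ => Complex.exp (((L Complex.I * x : ℝ) : ℂ) * Complex.I))]
  simp_rw [Complex.ofReal_mul, ← charFun_apply_real, charFun_gaussianReal]
  rw [← Complex.exp_add]
  congr 1
  push_cast
  simp
  ring

/-- The projection of `g` onto the disc of `x`, as a complex number. -/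
def discProj {n : ℕ} (x : Fin n → ℝ) (g : Fin n ⊕ Fin n → ℝ) : ℂ :=
  ⟨g ⬝ᵥ lift x, g ⬝ᵥ perp x⟩

theorem measurable_discProj {n : ℕ} (x : Fin n → ℝ) : Measurable (discProj x) := by
  have : discProj x = fun g => Complex.measurableEquivRealProd.symm (g ⬝ᵥ lift x, g ⬝ᵥ perp x) := rfl
  rw [this]
  refine Complex.measurableEquivRealProd.symm.measurable.comp ?_
  unfold dotProduct
  fun_prop

/-- Compare characteristic functions: a real functional of the pair is the dot product of `g` with a
fixed vector, whose squared length is a sum of four squares because `u, w` are orthonormal. -/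
theorem map_discProj_prod {n : ℕ} {u w : Fin n → ℝ} (hu : u ⬝ᵥ u = 1) (hw : w ⬝ᵥ w = 1)
    (huw : u ⬝ᵥ w = 0) :
    (Measure.pi fun _ : Fin n ⊕ Fin n => gaussianReal 0 1).map
      (fun g => (discProj u g, discProj w g)) = complexGaussian.prod complexGaussian := by
  have hT : Measurable fun g : Fin n ⊕ Fin n → ℝ => (discProj u g, discProj w g) :=
    (measurable_discProj u).prodMk (measurable_discProj w)
  have : IsProbabilityMeasure ((Measure.pi fun _ : Fin n ⊕ Fin n => gaussianReal 0 1).map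
      (fun g => (discProj u g, discProj w g))) :=
    Measure.isProbabilityMeasure_map hT.aemeasurable
  apply Measure.ext_of_charFunDual
  ext L
  rw [charFunDual_prod, charFunDual_complexGaussian, charFunDual_complexGaussian, charFunDual_apply,
    integral_map hT.aemeasurable (by fun_prop)]
  simp only [ContinuousLinearMap.comp_apply, ContinuousLinearMap.inl_apply,
    ContinuousLinearMap.inr_apply]
  set a := L (1, 0)
  set b := L (Complex.I, 0)
  set c := L (0, 1)
  set d := L (0, Complex.I)
  have hL : ∀ g, L (discProj u g, discProj w g) =
      ∑ i, g i * Sum.elim (fun j => a * u j + c * w j) (fun j => b * u j + d * w j) i := by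
    intro g
    have : (discProj u g, discProj w g) = (g ⬝ᵥ lift u) • ((1 : ℂ), (0 : ℂ)) +
        (g ⬝ᵥ perp u) • (Complex.I, (0 : ℂ)) + (g ⬝ᵥ lift w) • ((0 : ℂ), (1 : ℂ)) +
        (g ⬝ᵥ perp w) • ((0 : ℂ), Complex.I) := by
      ext <;> simp [discProj, Complex.mk_eq_add_mul_I]
    rw [this]
    simp only [map_add, map_smul, smul_eq_mul]
    simp only [dotProduct, lift, perp, Fintype.sum_sum_type, Sum.elim_inl, Sum.elim_inr,
      Pi.zero_apply, mul_zero, Finset.sum_const_zero, add_zero, zero_add, Finset.sum_mul]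
    rw [add_assoc, add_add_add_comm, ← Finset.sum_add_distrib, ← Finset.sum_add_distrib]
    congr 1 <;> exact Finset.sum_congr rfl fun j _ => by ring
  simp_rw [hL]
  rw [integral_exp_dotProduct_pi_gaussianReal, ← Complex.exp_add]
  have hsum : ∀ p q : ℝ, ∑ j, (p * u j + q * w j) ^ 2 = p ^ 2 + q ^ 2 := by
    intro p q
    have h1 : ∑ j, (p * u j + q * w j) ^ 2 =
        p ^ 2 * (u ⬝ᵥ u) + 2 * p * q * (u ⬝ᵥ w) + q ^ 2 * (w ⬝ᵥ w) := by
      simp only [dotProduct, Finset.mul_sum, ← Finset.sum_add_distrib]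
      exact Finset.sum_congr rfl fun j _ => by ring
    rw [h1, hu, hw, huw]
    ring
  congr 1
  simp only [Fintype.sum_sum_type, Sum.elim_inl, Sum.elim_inr, hsum]
  push_cast
  ring

theorem lintegral_comp_mul_add {f : ℂ → ℝ≥0∞} (hf : Measurable f) {a : ℂ} (ha : a ≠ 0) (b : ℂ) :
    ∫⁻ w, f w = ENNReal.ofReal (‖a‖ ^ 2) * ∫⁻ ζ, f (a * ζ + b) := by
  have hdet : LinearMap.det (LinearMap.mulLeft ℝ a) = ‖a‖ ^ 2 := by
    rw [Complex.sq_norm, ← Algebra.norm_complex_apply, Algebra.norm_apply]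
    rfl
  have hpos : 0 < ‖a‖ ^ 2 := by positivity
  have hmap := Measure.map_linearMap_addHaar_eq_smul_addHaar (volume : Measure ℂ)
    (f := LinearMap.mulLeft ℝ a) (by rw [hdet]; exact hpos.ne')
  have h1 : ∫⁻ ζ, f (a * ζ + b) = ∫⁻ w, f (w + b) ∂(volume.map (LinearMap.mulLeft ℝ a)) := by
    rw [lintegral_map (f := fun w => f (w + b)) (hf.comp (measurable_add_const b))
      (LinearMap.continuous_of_finiteDimensional _).measurable]
    rfl
  rw [h1, hmap, lintegral_smul_measure, hdet, lintegral_add_right_eq_self f b, smul_eq_mul,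
    ← mul_assoc, ← ENNReal.ofReal_mul hpos.le, abs_of_pos (inv_pos.2 hpos),
    mul_inv_cancel₀ hpos.ne', ENNReal.ofReal_one, one_mul]

/-- Gives the density of the ratio `ζ = w/z` of independent complex Gaussians: `‖z‖²` is the
Jacobian of `w = zζ`, and integrating out `z` is a Gamma integral. -/
theorem lintegral_complexGaussianPDF_mul (ζ : ℂ) :
    ∫⁻ z : ℂ, ENNReal.ofReal (‖z‖ ^ 2) * (complexGaussianPDF z * complexGaussianPDF (z * ζ)) =
      ENNReal.ofReal (1 / (π * (1 + ‖ζ‖ ^ 2) ^ 2)) := by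
  have hb : 0 < (1 + ‖ζ‖ ^ 2) / 2 := by positivity
  have h := Complex.integral_rpow_mul_exp_neg_mul_rpow (p := 2) (q := 2) one_le_two
    (by norm_num) hb
  have hval : (2 * π / 2) * ((1 + ‖ζ‖ ^ 2) / 2) ^ (-(2 + 2) / 2 : ℝ) * Real.Gamma ((2 + 2) / 2) =
      4 * π / (1 + ‖ζ‖ ^ 2) ^ 2 := by
    rw [show ((2 : ℝ) + 2) / 2 = (1 : ℕ) + 1 by norm_num, Real.Gamma_nat_eq_factorial,
      show (-(2 + 2) / 2 : ℝ) = -(2 : ℕ) by norm_num, Real.rpow_neg hb.le, Real.rpow_natCast]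
    field_simp
    norm_num
  rw [hval] at h
  have hpt : ∀ z : ℂ, ENNReal.ofReal (‖z‖ ^ 2) *
      (complexGaussianPDF z * complexGaussianPDF (z * ζ)) =
      ENNReal.ofReal ((2 * π)⁻¹ ^ 2 *
        (‖z‖ ^ (2 : ℝ) * Real.exp (-((1 + ‖ζ‖ ^ 2) / 2) * ‖z‖ ^ (2 : ℝ)))) := by
    intro z
    rw [complexGaussianPDF, complexGaussianPDF, ← ENNReal.ofReal_mul (by positivity),
      ← ENNReal.ofReal_mul (by positivity)]
    congr 1
    rw [Real.rpow_two, mul_mul_mul_comm (2 * π)⁻¹, ← Real.exp_add, norm_mul]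
    ring_nf
  have hint : Integrable fun z : ℂ =>
      ‖z‖ ^ (2 : ℝ) * Real.exp (-((1 + ‖ζ‖ ^ 2) / 2) * ‖z‖ ^ (2 : ℝ)) := by
    -- The closed formula for the integral is nonzero, whereas the integral of a non-integrable
    -- function is zero by convention.
    by_contra hni
    rw [integral_undef hni] at h
    have : 0 < 4 * π / (1 + ‖ζ‖ ^ 2) ^ 2 := by positivity
    linarith
  simp_rw [hpt]
  rw [← ofReal_integral_eq_lintegral_ofReal (hint.const_mul _)
    (ae_of_all _ fun z => by positivity), integral_const_mul, h]
  congr 1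
  have := Real.pi_pos
  field_simp
  norm_num

end
end MaxKCut

/-! ### The law of the angle between correlated complex Gaussians. -/

namespace MaxKCut
noncomputable section

open MeasureTheory ProbabilityTheory
open scoped Real ENNReal

/-- The denominator is the square of `(r - c)² + (1 - c²)`, so there is an explicit antiderivative
with rational terms and an arctangent. Its boundary terms at `0` and infinity combine to `π/2 +
arcsin c = arccos(-c)`. -/
theorem lintegral_radial {c : ℝ} (h₁ : -1 < c) (h₂ : c < 1) :
    ∫⁻ r in Set.Ioi (0 : ℝ), ENNReal.ofReal (r / (1 - 2 * c * r + r ^ 2) ^ 2) =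
      ENNReal.ofReal (arccosSqDeriv c / 2) := by
  have hp : 0 < 1 - c ^ 2 := by nlinarith
  obtain ⟨t, ht, htsq, hts⟩ : ∃ t : ℝ, 0 < t ∧ t ^ 2 = 1 - c ^ 2 ∧ √(1 - c ^ 2) = t :=
    ⟨_, Real.sqrt_pos.2 hp, Real.sq_sqrt hp.le, rfl⟩
  have hD : ∀ r : ℝ, 0 < 1 - 2 * c * r + r ^ 2 := fun r => by nlinarith [sq_nonneg (r - c)]
  set G : ℝ → ℝ := fun r => c / (2 * t ^ 2) * ((r - c) / (1 - 2 * c * r + r ^ 2)) -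
    1 / 2 * (1 - 2 * c * r + r ^ 2)⁻¹ + c / (2 * t ^ 3) * Real.arctan ((r - c) / t) with hG
  have hderiv : ∀ r ∈ Set.Ici (0 : ℝ), HasDerivAt G (r / (1 - 2 * c * r + r ^ 2) ^ 2) r := by
    intro r _
    have hd : HasDerivAt (fun r : ℝ => 1 - 2 * c * r + r ^ 2) (2 * (r - c)) r := by
      refine ((((hasDerivAt_id r).const_mul (2 * c)).const_sub 1).add
        (hasDerivAt_pow 2 r)).congr_deriv ?_
      simp
      ring
    have hn : HasDerivAt (fun r : ℝ => r - c) 1 r := (hasDerivAt_id r).sub_const c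
    refine ((((hn.div hd (hD r).ne').const_mul (c / (2 * t ^ 2))).sub
      ((hd.inv (hD r).ne').const_mul (1 / 2))).add
      ((hn.div_const t).arctan.const_mul (c / (2 * t ^ 3)))).congr_deriv ?_
    have e1 : 1 + ((r - c) / t) ^ 2 = (1 - 2 * c * r + r ^ 2) / t ^ 2 := by
      field_simp
      rw [htsq]
      ring
    rw [e1]
    have := hD r
    field_simp
    rw [htsq]
    ring
  have hnn : ∀ r ∈ Set.Ioi (0 : ℝ), 0 ≤ r / (1 - 2 * c * r + r ^ 2) ^ 2 := fun r hr =>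
    div_nonneg (le_of_lt hr) (by positivity)
  have hlim : Filter.Tendsto G Filter.atTop (nhds (c / (2 * t ^ 3) * (π / 2))) := by
    have hq : Filter.Tendsto (fun r : ℝ => 1 - 2 * c * r + r ^ 2) Filter.atTop Filter.atTop := by
      have : ∀ r : ℝ, 1 - 2 * c * r + r ^ 2 = (r - c) ^ 2 + t ^ 2 := fun r => by rw [htsq]; ring
      simp only [this]
      exact Filter.tendsto_atTop_add_const_right _ _
        ((Filter.tendsto_pow_atTop two_ne_zero).comp
          (Filter.tendsto_atTop_add_const_right _ (-c) Filter.tendsto_id))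
    have hx : Filter.Tendsto (fun r : ℝ => r - c) Filter.atTop Filter.atTop :=
      Filter.tendsto_atTop_add_const_right _ (-c) Filter.tendsto_id
    have l1 : Filter.Tendsto (fun r : ℝ => (r - c) / (1 - 2 * c * r + r ^ 2)) Filter.atTop
        (nhds 0) := by
      refine squeeze_zero' (g := fun r => (r - c)⁻¹) ?_ ?_ (tendsto_inv_atTop_zero.comp hx)
      · filter_upwards [Filter.eventually_gt_atTop c] with r hr
        exact div_nonneg (by linarith) (hD r).le
      · filter_upwards [Filter.eventually_gt_atTop c] with r hr
        have : 0 < r - c := by linarith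
        rw [inv_eq_one_div, div_le_div_iff₀ (hD r) this]
        nlinarith
    have l2 : Filter.Tendsto (fun r : ℝ => (1 - 2 * c * r + r ^ 2)⁻¹) Filter.atTop (nhds 0) :=
      tendsto_inv_atTop_zero.comp hq
    have l3 : Filter.Tendsto (fun r : ℝ => Real.arctan ((r - c) / t)) Filter.atTop
        (nhds (π / 2)) :=
      (Real.tendsto_arctan_atTop.mono_right nhdsWithin_le_nhds).comp (hx.atTop_div_const ht)
    have := ((l1.const_mul (c / (2 * t ^ 2))).sub (l2.const_mul (1 / 2))).add
      (l3.const_mul (c / (2 * t ^ 3)))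
    simpa [hG] using this
  have hint := integrableOn_Ioi_deriv_of_nonneg' hderiv hnn hlim
  rw [← ofReal_integral_eq_lintegral_ofReal hint
    ((ae_restrict_iff' measurableSet_Ioi).2 (ae_of_all _ hnn)),
    integral_Ioi_of_hasDerivAt_of_nonneg' hderiv hnn hlim]
  congr 1
  have harc : Real.arctan ((0 - c) / t) = -Real.arcsin c := by
    rw [zero_sub, neg_div, Real.arctan_neg, Real.arcsin_eq_arctan ⟨h₁, h₂⟩, hts]
  rw [hG]
  simp only [harc]
  rw [arccosSqDeriv, Real.arccos_neg, Real.arccos, hts, ← htsq]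
  have : c ^ 2 = 1 - t ^ 2 := by rw [htsq]; ring
  field_simp
  ring_nf
  rw [this]
  ring

theorem measurable_cos_arg_sub_arg {α : Type*} [MeasurableSpace α] {f g : α → ℂ}
    (hf : Measurable f) (hg : Measurable g) :
    Measurable fun a => Real.cos (Complex.arg (f a) - Complex.arg (g a)) :=
  Real.measurable_cos.comp ((Complex.measurable_arg.comp hf).sub (Complex.measurable_arg.comp hg))

theorem measurable_cos_arg_affine (ρ s : ℝ) :
    Measurable fun ζ : ℂ => Real.cos (Complex.arg (s * ζ + ρ)) :=
  Real.measurable_cos.comp (Complex.measurable_arg.comp (by fun_prop))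

/-- Substitute `w = zζ`: then `ρz + sw = z(ρ + sζ)`, so the angle to `z` is the argument of `ρ + sζ`
and no longer involves `z`. The point where this factor vanishes is null. -/
theorem lintegral_complexGaussianPDF_mul_cos_arg {T : ℝ → ℝ≥0∞} (hT : Measurable T) (ρ : ℝ)
    {s : ℝ} (hs : 0 < s) {z : ℂ} (hz : z ≠ 0) :
    ∫⁻ w, complexGaussianPDF w * T (Real.cos (Complex.arg (ρ * z + s * w) - Complex.arg z)) =
      ENNReal.ofReal (‖z‖ ^ 2) * ∫⁻ ζ, complexGaussianPDF (z * ζ) *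
        T (Real.cos (Complex.arg (s * ζ + ρ))) := by
  have hsC : (s : ℂ) ≠ 0 := Complex.ofReal_ne_zero.2 hs.ne'
  have hFz : Measurable fun w : ℂ =>
      T (Real.cos (Complex.arg (ρ * z + s * w) - Complex.arg z)) :=
    hT.comp (measurable_cos_arg_sub_arg (by fun_prop) (by fun_prop))
  rw [lintegral_comp_mul_add (f := fun w => complexGaussianPDF w *
    T (Real.cos (Complex.arg (ρ * z + s * w) - Complex.arg z)))
    (measurable_complexGaussianPDF.mul hFz) hz 0]
  congr 1
  refine lintegral_congr_ae ?_
  have hae : ∀ᵐ ζ : ℂ, ζ ≠ -ρ / s := compl_mem_ae_iff.2 (measure_singleton _)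
  filter_upwards [hae] with ζ hζ
  have hη : (s * ζ + ρ : ℂ) ≠ 0 := by
    intro h0
    apply hζ
    rw [eq_div_iff hsC]
    linear_combination h0
  simp only [add_zero]
  rw [show (ρ * z + s * (z * ζ) : ℂ) = z * (s * ζ + ρ) by ring,
    ← Real.Angle.cos_coe (_ - _), Real.Angle.coe_sub, Complex.arg_mul_coe_angle hz hη,
    add_sub_cancel_left, Real.Angle.cos_coe]

theorem lintegral_cos_arg_sub_arg {T : ℝ → ℝ≥0∞} (hT : Measurable T) (ρ : ℝ) {s : ℝ}
    (hs : 0 < s) :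
    ∫⁻ p : ℂ × ℂ, T (Real.cos (Complex.arg (ρ * p.1 + s * p.2) - Complex.arg p.1))
        ∂(complexGaussian.prod complexGaussian) =
      ∫⁻ ζ : ℂ, T (Real.cos (Complex.arg (s * ζ + ρ))) *
        ENNReal.ofReal (1 / (π * (1 + ‖ζ‖ ^ 2) ^ 2)) := by
  have hF : Measurable fun p : ℂ × ℂ =>
      T (Real.cos (Complex.arg (ρ * p.1 + s * p.2) - Complex.arg p.1)) :=
    hT.comp (measurable_cos_arg_sub_arg (by fun_prop) (by fun_prop))
  have hp := measurable_complexGaussianPDF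
  have hG : Measurable fun ζ : ℂ => T (Real.cos (Complex.arg (s * ζ + ρ))) :=
    hT.comp (measurable_cos_arg_affine ρ s)
  have hm : Measurable fun z : ℂ => ∫⁻ w,
      T (Real.cos (Complex.arg (ρ * z + s * w) - Complex.arg z)) ∂complexGaussian :=
    hF.lintegral_prod_right'
  rw [complexGaussian_eq_withDensity] at hm
  rw [lintegral_prod _ hF.aemeasurable, complexGaussian_eq_withDensity,
    lintegral_withDensity_eq_lintegral_mul _ hp hm]
  have hae : ∀ᵐ z : ℂ, z ≠ 0 := compl_mem_ae_iff.2 (measure_singleton _)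
  have h1 : ∀ᵐ z : ℂ, (complexGaussianPDF * fun z => ∫⁻ w,
        T (Real.cos (Complex.arg (ρ * z + s * w) - Complex.arg z))
          ∂(volume.withDensity complexGaussianPDF)) z =
      ∫⁻ ζ, T (Real.cos (Complex.arg (s * ζ + ρ))) * (ENNReal.ofReal (‖z‖ ^ 2) *
        (complexGaussianPDF z * complexGaussianPDF (z * ζ))) := by
    filter_upwards [hae] with z hz
    have hFz : Measurable fun w : ℂ =>
        T (Real.cos (Complex.arg (ρ * z + s * w) - Complex.arg z)) :=
      hT.comp (measurable_cos_arg_sub_arg (by fun_prop) (by fun_prop))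
    rw [Pi.mul_apply, lintegral_withDensity_eq_lintegral_mul _ hp hFz]
    simp only [Pi.mul_apply]
    rw [lintegral_complexGaussianPDF_mul_cos_arg hT ρ hs hz, ← lintegral_const_mul _ (by fun_prop),
      ← lintegral_const_mul _ (by fun_prop)]
    refine lintegral_congr fun ζ => ?_
    ring
  rw [lintegral_congr_ae h1, lintegral_lintegral_swap (by
    apply Measurable.aemeasurable
    fun_prop)]
  refine lintegral_congr fun ζ => ?_
  rw [lintegral_const_mul _ (by fun_prop), lintegral_complexGaussianPDF_mul]

theorem neg_one_lt_mul_cos_and_lt_one {ρ : ℝ} (h₁ : -1 < ρ) (h₂ : ρ < 1) (x : ℝ) :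
    -1 < ρ * Real.cos x ∧ ρ * Real.cos x < 1 := by
  have hρ : |ρ| < 1 := abs_lt.2 ⟨h₁, h₂⟩
  rw [← abs_lt, abs_mul]
  have := Real.abs_cos_le_one x
  nlinarith [abs_nonneg ρ, abs_nonneg (Real.cos x)]

/-- The density of the angle between two unit-variance complex Gaussians of correlation `ρ`. -/
def angleDensity (ρ δ : ℝ) : ℝ := (1 - ρ ^ 2) / (2 * π) * arccosSqDeriv (ρ * Real.cos δ)

/-- Recentre by `η = sζ + ρ`, which turns `s²(1 + ‖ζ‖²)` into `1 - 2ρ Re η + ‖η‖²`, pass to polar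
coordinates, and integrate out the radius at fixed angle. -/
theorem lintegral_cos_angle {T : ℝ → ℝ≥0∞} (hT : Measurable T) {ρ s : ℝ} (hs : 0 < s)
    (hρs : ρ ^ 2 + s ^ 2 = 1) :
    ∫⁻ p : ℂ × ℂ, T (Real.cos (Complex.arg (ρ * p.1 + s * p.2) - Complex.arg p.1))
        ∂(complexGaussian.prod complexGaussian) =
      ∫⁻ δ in Set.Ioo (-π) π, T (Real.cos δ) * ENNReal.ofReal (angleDensity ρ δ) := by
  have hsC : (s : ℂ) ≠ 0 := Complex.ofReal_ne_zero.2 hs.ne'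
  have hπ := Real.pi_pos
  rw [lintegral_cos_arg_sub_arg hT ρ hs]
  set f : ℂ → ℝ≥0∞ := fun η => T (Real.cos (Complex.arg η)) *
    ENNReal.ofReal (s ^ 2 / (π * (1 - 2 * ρ * η.re + ‖η‖ ^ 2) ^ 2)) with hf
  have hfm : Measurable f := by
    have : Measurable fun η : ℂ => T (Real.cos (Complex.arg η)) :=
      hT.comp (Real.measurable_cos.comp Complex.measurable_arg)
    have h2 : Measurable fun η : ℂ => η.re := Complex.measurable_re
    rw [hf]
    fun_prop
  have h1 : ∫⁻ ζ : ℂ, T (Real.cos (Complex.arg (s * ζ + ρ))) *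
        ENNReal.ofReal (1 / (π * (1 + ‖ζ‖ ^ 2) ^ 2)) = ∫⁻ η, f η := by
    rw [lintegral_comp_mul_add hfm hsC ρ, ← lintegral_const_mul _ (by fun_prop)]
    refine lintegral_congr fun ζ => ?_
    simp only [hf]
    rw [mul_left_comm, ← ENNReal.ofReal_mul (by positivity)]
    congr 2
    have hn : 1 - 2 * ρ * (s * ζ + ρ : ℂ).re + ‖(s * ζ + ρ : ℂ)‖ ^ 2 = s ^ 2 * (1 + ‖ζ‖ ^ 2) := by
      simp only [Complex.sq_norm, Complex.normSq_apply]
      simp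
      linear_combination -hρs
    rw [hn, Complex.norm_real, Real.norm_eq_abs, sq_abs]
    field_simp
  rw [h1, ← Complex.lintegral_comp_polarCoord_symm, polarCoord_target, Measure.volume_eq_prod,
    ← Measure.prod_restrict, lintegral_prod_symm _ (by
      apply Measurable.aemeasurable
      have : Measurable fun p : ℝ × ℝ => f (Complex.polarCoord.symm p) := by
        simp only [Complex.polarCoord_symm_apply]
        exact hfm.comp (by fun_prop)
      exact (ENNReal.measurable_ofReal.comp measurable_fst).smul this)]
  refine setLIntegral_congr_fun measurableSet_Ioo fun δ hδ => ?_
  have hc := neg_one_lt_mul_cos_and_lt_one (ρ := ρ) (by nlinarith) (by nlinarith) δ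
  have h2 : ∀ r ∈ Set.Ioi (0 : ℝ),
      ENNReal.ofReal r • f (Complex.polarCoord.symm (r, δ)) =
      T (Real.cos δ) * ENNReal.ofReal (s ^ 2 / π) *
        ENNReal.ofReal (r / (1 - 2 * (ρ * Real.cos δ) * r + r ^ 2) ^ 2) := by
    intro r hr
    have hr0 : (0 : ℝ) < r := hr
    have harg : Complex.arg (Complex.polarCoord.symm (r, δ)) = δ := by
      rw [Complex.polarCoord_symm_apply]
      push_cast
      exact Complex.arg_mul_cos_add_sin_mul_I hr0 ⟨hδ.1, hδ.2.le⟩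
    have hre : (Complex.polarCoord.symm (r, δ)).re = r * Real.cos δ := by
      rw [Complex.polarCoord_symm_apply]
      simp [-Complex.ofReal_cos, -Complex.ofReal_sin]
    have hnorm : ‖Complex.polarCoord.symm (r, δ)‖ ^ 2 = r ^ 2 := by
      rw [Complex.norm_polarCoord_symm, sq_abs]
    simp only [hf, harg, hre, hnorm, smul_eq_mul]
    rw [mul_left_comm, mul_assoc (T _), ← ENNReal.ofReal_mul hr0.le,
      ← ENNReal.ofReal_mul (p := s ^ 2 / π) (by positivity)]
    have e : 1 - 2 * ρ * (r * Real.cos δ) + r ^ 2 =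
        1 - 2 * (ρ * Real.cos δ) * r + r ^ 2 := by ring
    rw [e, div_mul_div_comm, ← mul_div_assoc, mul_comm r]
  rw [setLIntegral_congr_fun measurableSet_Ioi h2, lintegral_const_mul _ (by fun_prop),
    lintegral_radial hc.1 hc.2, mul_assoc, ← ENNReal.ofReal_mul (by positivity), angleDensity]
  congr 2
  rw [← hρs]
  ring

end
end MaxKCut

/-! ### The separation probability of a pair of vectors. -/

namespace MaxKCut
noncomputable section

open MeasureTheory ProbabilityTheory
open scoped Real ENNReal

theorem continuous_angleDensity {ρ : ℝ} (h₁ : -1 < ρ) (h₂ : ρ < 1) :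
    Continuous (angleDensity ρ) := by
  have hpos : ∀ x, 0 < 1 - (ρ * Real.cos x) ^ 2 := fun x => by
    have := neg_one_lt_mul_cos_and_lt_one h₁ h₂ x
    nlinarith
  unfold angleDensity arccosSqDeriv
  refine continuous_const.mul (Continuous.add ?_ ?_)
  · exact continuous_const.div (by fun_prop) fun x => (hpos x).ne'
  · refine Continuous.div (by fun_prop) (by fun_prop) fun x => ?_
    exact (pow_pos (Real.sqrt_pos.2 (hpos x)) 3).ne'

theorem angleDensity_nonneg {ρ : ℝ} (h₁ : -1 < ρ) (h₂ : ρ < 1) (x : ℝ) :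
    0 ≤ angleDensity ρ x := by
  have hc := neg_one_lt_mul_cos_and_lt_one h₁ h₂ x
  have hq := arccosSqDeriv_nonneg hc.1 hc.2
  have : 0 ≤ 1 - ρ ^ 2 := by nlinarith
  have := Real.pi_pos
  unfold angleDensity
  positivity

/-- An antiderivative of twice the density of the angle. -/
def angleCDF (ρ x : ℝ) : ℝ :=
  x / π + ρ * Real.sin x / π *
    (Real.arccos (-(ρ * Real.cos x)) / √(1 - (ρ * Real.cos x) ^ 2))

theorem hasDerivAt_mul_cos (ρ x : ℝ) :
    HasDerivAt (fun y => ρ * Real.cos y) (-(ρ * Real.sin x)) x :=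
  ((Real.hasDerivAt_cos x).const_mul ρ).congr_deriv (by ring)

theorem hasDerivAt_angleCDF {ρ : ℝ} (h₁ : -1 < ρ) (h₂ : ρ < 1) (x : ℝ) :
    HasDerivAt (angleCDF ρ) (2 * angleDensity ρ x) x := by
  have hc := neg_one_lt_mul_cos_and_lt_one h₁ h₂ x
  have hp : 0 < 1 - (ρ * Real.cos x) ^ 2 := by nlinarith
  have hD := (hasDerivAt_arccos_neg_div hc.1 hc.2).comp x (hasDerivAt_mul_cos ρ x)
  have hs := ((Real.hasDerivAt_sin x).const_mul ρ).div_const π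
  refine (((hasDerivAt_id x).div_const π).add (hs.mul hD)).congr_deriv ?_
  -- With `D(x) = arccos(-x)/√(1 - x²)` and `D' = arccosSqDeriv`, this is the differential equation
  -- `(1 - x²) D' = 1 + x D`; it collapses the product-rule terms to the density.
  have hode : (1 - (ρ * Real.cos x) ^ 2) * arccosSqDeriv (ρ * Real.cos x) = 1 + ρ * Real.cos x *
      (Real.arccos (-(ρ * Real.cos x)) / √(1 - (ρ * Real.cos x) ^ 2)) := by
    obtain ⟨t, ht, htsq, hts⟩ : ∃ t : ℝ, 0 < t ∧ t ^ 2 = 1 - (ρ * Real.cos x) ^ 2 ∧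
        √(1 - (ρ * Real.cos x) ^ 2) = t := ⟨_, Real.sqrt_pos.2 hp, Real.sq_sqrt hp.le, rfl⟩
    rw [arccosSqDeriv, hts, ← htsq]
    field_simp
  simp only [angleDensity, Function.comp_apply]
  have hsin : Real.sin x ^ 2 = 1 - Real.cos x ^ 2 := Real.sin_sq x
  generalize Real.arccos (-(ρ * Real.cos x)) / √(1 - (ρ * Real.cos x) ^ 2) = D at *
  generalize arccosSqDeriv (ρ * Real.cos x) = q at *
  have hπ := Real.pi_pos
  field_simp
  linear_combination (-1 : ℝ) * hode - ρ ^ 2 * q * hsin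

theorem hasDerivAt_arccos_mul_cos {ρ : ℝ} (h₁ : -1 < ρ) (h₂ : ρ < 1) (x : ℝ) :
    HasDerivAt (fun y => (y ^ 2 - Real.arccos (-(ρ * Real.cos y)) ^ 2) / (2 * π))
      (angleCDF ρ x) x := by
  have hc := neg_one_lt_mul_cos_and_lt_one h₁ h₂ x
  have h := (hasDerivAt_arccos_neg_sq hc.1 hc.2).comp x (hasDerivAt_mul_cos ρ x)
  refine (((hasDerivAt_pow 2 x).sub h).div_const (2 * π)).congr_deriv ?_
  rw [angleCDF]
  have hπ := Real.pi_pos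
  generalize Real.arccos (-(ρ * Real.cos x)) / √(1 - (ρ * Real.cos x) ^ 2) = D at *
  field_simp
  simp
  ring

theorem two_pi_div_le_pi {k : ℕ} (hk : 3 ≤ k) : 2 * π / k ≤ π := by
  have hk3 : (3 : ℝ) ≤ k := by exact_mod_cast hk
  rw [div_le_iff₀ (by linarith)]
  nlinarith [Real.pi_pos]

theorem continuous_tent (k : ℕ) : Continuous (tent k) := by
  unfold tent
  fun_prop

theorem tent_nonneg (k : ℕ) (x : ℝ) : 0 ≤ tent k x := le_max_right _ _

theorem tent_le_one {k : ℕ} {x : ℝ} (hx : 0 ≤ x) : tent k x ≤ 1 := by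
  have : 0 ≤ x / (2 * π / k) := by positivity
  exact max_le (by linarith) zero_le_one

/-- Evenness folds the integral onto `[0, π]`, the tent cuts it off at `2π/k`, and on the remaining
interval the tent is linear. Integration by parts leaves a difference of second antiderivatives,
since the first antiderivative vanishes at `0` and the tent at `2π/k`. -/
theorem integral_tent_mul_angleDensity {k : ℕ} (hk : 3 ≤ k) {ρ : ℝ} (h₁ : -1 < ρ) (h₂ : ρ < 1) :
    ∫ δ in (-π)..π, tent k (Real.arccos (Real.cos δ)) * angleDensity ρ δ =
      1 - separationProb k ρ := by
  have hπ := Real.pi_pos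
  have hk3 : (3 : ℝ) ≤ k := by exact_mod_cast hk
  have hle := two_pi_div_le_pi hk
  have hh : 0 < 2 * π / k := by positivity
  have hcont : Continuous fun δ => tent k (Real.arccos (Real.cos δ)) * angleDensity ρ δ :=
    ((continuous_tent k).comp (by fun_prop)).mul (continuous_angleDensity h₁ h₂)
  have hint : ∀ a b, IntervalIntegrable
      (fun δ => tent k (Real.arccos (Real.cos δ)) * angleDensity ρ δ) volume a b :=
    fun a b => hcont.intervalIntegrable a b
  have hneg : ∫ δ in (-π)..0, tent k (Real.arccos (Real.cos δ)) * angleDensity ρ δ =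
      ∫ δ in (0)..π, tent k (Real.arccos (Real.cos δ)) * angleDensity ρ δ := by
    have := intervalIntegral.integral_comp_neg (a := 0) (b := π)
      (fun δ => tent k (Real.arccos (Real.cos δ)) * angleDensity ρ δ)
    rw [neg_zero] at this
    rw [← this]
    simp [angleDensity]
  have htail : ∫ δ in (2 * π / k)..π, tent k (Real.arccos (Real.cos δ)) * angleDensity ρ δ = 0 := by
    rw [intervalIntegral.integral_congr (g := fun _ => 0)]
    · simp
    · intro δ hδ
      rw [Set.uIcc_of_le hle] at hδ
      simp only [Real.arccos_cos (hh.le.trans hδ.1) hδ.2, tent]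
      rw [max_eq_right (by rw [sub_nonpos, one_le_div hh]; exact hδ.1), zero_mul]
  set h := 2 * π / k with hdef
  have hhead : ∫ δ in (0)..h, tent k (Real.arccos (Real.cos δ)) * angleDensity ρ δ =
      ∫ δ in (0)..h, (1 - δ / h) * angleDensity ρ δ := by
    refine intervalIntegral.integral_congr fun δ hδ => ?_
    rw [Set.uIcc_of_le hh.le] at hδ
    simp only [Real.arccos_cos hδ.1 (hδ.2.trans hle), tent, ← hdef]
    rw [max_eq_left (by rw [sub_nonneg, div_le_one hh]; exact hδ.2)]
  have hprim : ∀ x ∈ Set.uIcc 0 h, HasDerivAt (fun x => ((1 - x / h) * angleCDF ρ x +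
      (x ^ 2 - Real.arccos (-(ρ * Real.cos x)) ^ 2) / (2 * π) / h) / 2)
      ((1 - x / h) * angleDensity ρ x) x := by
    intro x _
    have hl : HasDerivAt (fun x : ℝ => 1 - x / h) (-(1 / h)) x :=
      ((hasDerivAt_id x).div_const h).const_sub 1
    refine (((hl.mul (hasDerivAt_angleCDF h₁ h₂ x)).add
      ((hasDerivAt_arccos_mul_cos h₁ h₂ x).div_const h)).div_const 2).congr_deriv ?_
    field_simp
    ring
  have hcont2 : Continuous fun x => (1 - x / h) * angleDensity ρ x :=
    Continuous.mul (by fun_prop) (continuous_angleDensity h₁ h₂)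
  rw [← intervalIntegral.integral_add_adjacent_intervals (hint _ 0) (hint 0 _), hneg,
    ← intervalIntegral.integral_add_adjacent_intervals (hint 0 h) (hint h _), htail, hhead,
    intervalIntegral.integral_eq_sub_of_hasDerivAt hprim (hcont2.intervalIntegrable _ _),
    separationProb, ← hdef]
  have e0 : angleCDF ρ 0 = 0 := by simp [angleCDF]
  rw [e0, div_self hh.ne', Real.cos_zero, mul_one, mul_comm (Real.cos h) ρ]
  generalize Real.arccos (-(ρ * Real.cos h)) = A
  generalize Real.arccos (-ρ) = B
  rw [hdef]
  field_simp
  ring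

theorem separationProb_le_one {k : ℕ} (hk : 3 ≤ k) {ρ : ℝ} (h₁ : -1 < ρ) (h₂ : ρ < 1) :
    separationProb k ρ ≤ 1 := by
  rw [← sub_nonneg, ← integral_tent_mul_angleDensity hk h₁ h₂]
  exact intervalIntegral.integral_nonneg (by linarith [Real.pi_pos]) fun δ _ =>
    mul_nonneg (tent_nonneg _ _) (angleDensity_nonneg h₁ h₂ δ)

theorem lintegral_ofReal_tent {k : ℕ} (hk : 3 ≤ k) {ρ s : ℝ} (hs : 0 < s)
    (hρs : ρ ^ 2 + s ^ 2 = 1) :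
    ∫⁻ p : ℂ × ℂ, ENNReal.ofReal (tent k (Real.arccos (Real.cos
        (Complex.arg (ρ * p.1 + s * p.2) - Complex.arg p.1))))
        ∂(complexGaussian.prod complexGaussian) =
      ENNReal.ofReal (1 - separationProb k ρ) := by
  have h₁ : -1 < ρ := by nlinarith
  have h₂ : ρ < 1 := by nlinarith
  have hπ := Real.pi_pos
  have hcont : Continuous fun δ => tent k (Real.arccos (Real.cos δ)) * angleDensity ρ δ :=
    ((continuous_tent k).comp (by fun_prop)).mul (continuous_angleDensity h₁ h₂)
  have hT : Measurable fun x => ENNReal.ofReal (tent k (Real.arccos x)) :=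
    ENNReal.measurable_ofReal.comp
      ((continuous_tent k).comp Real.continuous_arccos).measurable
  have hnn : ∀ δ, 0 ≤ tent k (Real.arccos (Real.cos δ)) * angleDensity ρ δ := fun δ =>
    mul_nonneg (tent_nonneg _ _) (angleDensity_nonneg h₁ h₂ δ)
  rw [lintegral_cos_angle hT hs hρs, ← integral_tent_mul_angleDensity hk h₁ h₂,
    intervalIntegral.integral_of_le (by linarith), integral_Ioc_eq_integral_Ioo,
    ofReal_integral_eq_lintegral_ofReal
      ((hcont.integrableOn_Icc (a := -π) (b := π)).mono_set Set.Ioo_subset_Icc_self)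
      (ae_of_all _ hnn)]
  refine lintegral_congr fun δ => ?_
  rw [ENNReal.ofReal_mul (tent_nonneg _ _)]

theorem discAngle_eq {n : ℕ} (x : Fin n → ℝ) (g : Fin n ⊕ Fin n → ℝ) :
    discAngle x g = toIcoMod Real.two_pi_pos 0 (Complex.arg (discProj x g)) := rfl

theorem measurable_discAngle {n : ℕ} (x : Fin n → ℝ) : Measurable (discAngle x) :=
  measurable_toIcoMod_two_pi.comp (Complex.measurable_arg.comp (measurable_discProj x))

theorem cos_discAngle_sub {n : ℕ} (x y : Fin n → ℝ) (g : Fin n ⊕ Fin n → ℝ) :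
    Real.cos (discAngle y g - discAngle x g) =
      Real.cos (Complex.arg (discProj y g) - Complex.arg (discProj x g)) := by
  rw [discAngle_eq, discAngle_eq, ← Real.Angle.cos_coe, Real.Angle.coe_sub,
    Real.Angle.coe_toIcoMod, Real.Angle.coe_toIcoMod, ← Real.Angle.coe_sub, Real.Angle.cos_coe]

theorem discProj_add_smul {n : ℕ} (a b : ℝ) (x y : Fin n → ℝ) (g : Fin n ⊕ Fin n → ℝ) :
    discProj (a • x + b • y) g = a * discProj x g + b * discProj y g := by
  have h1 : g ⬝ᵥ lift (a • x + b • y) = a * (g ⬝ᵥ lift x) + b * (g ⬝ᵥ lift y) := by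
    rw [← smul_eq_mul, ← smul_eq_mul, ← dotProduct_smul, ← dotProduct_smul, ← dotProduct_add]
    congr 1
    ext i
    rcases i with i | i <;> simp [lift]
  have h2 : g ⬝ᵥ perp (a • x + b • y) = a * (g ⬝ᵥ perp x) + b * (g ⬝ᵥ perp y) := by
    rw [← smul_eq_mul, ← smul_eq_mul, ← dotProduct_smul, ← dotProduct_smul, ← dotProduct_add]
    congr 1
    ext i
    rcases i with i | i <;> simp [perp]
  apply Complex.ext <;> simp [discProj, h1, h2]

/-- Gram–Schmidt: `v = ρu + sw` with `w` a unit vector orthogonal to `u`. The disc projection is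
linear in the vector, so the law of the angle is that of the two-Gaussian model. -/
theorem lintegral_tent_discAngle {k n : ℕ} (hk : 3 ≤ k) {u v : Fin n → ℝ} (hu : u ⬝ᵥ u = 1)
    (hv : v ⬝ᵥ v = 1) (h₁ : -1 < u ⬝ᵥ v) (h₂ : u ⬝ᵥ v < 1) :
    ∫⁻ g, ENNReal.ofReal (tent k (Real.arccos (Real.cos (discAngle v g - discAngle u g))))
        ∂(Measure.pi fun _ : Fin n ⊕ Fin n => gaussianReal 0 1) =
      ENNReal.ofReal (1 - separationProb k (u ⬝ᵥ v)) := by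
  set ρ := u ⬝ᵥ v with hρ
  have hp : 0 < 1 - ρ ^ 2 := by nlinarith
  obtain ⟨s, hs, hs2⟩ : ∃ s : ℝ, 0 < s ∧ s ^ 2 = 1 - ρ ^ 2 :=
    ⟨_, Real.sqrt_pos.2 hp, Real.sq_sqrt hp.le⟩
  set w : Fin n → ℝ := s⁻¹ • (v - ρ • u) with hw
  have hvw : v = ρ • u + s • w := by
    rw [hw, smul_smul, mul_inv_cancel₀ hs.ne', one_smul]
    abel
  have huw : u ⬝ᵥ w = 0 := by
    rw [hw, dotProduct_smul, dotProduct_sub, dotProduct_smul, hu, ← hρ]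
    simp
  have hww : w ⬝ᵥ w = 1 := by
    rw [hw, dotProduct_smul, smul_dotProduct, sub_dotProduct, dotProduct_sub, dotProduct_sub,
      smul_dotProduct, smul_dotProduct, dotProduct_smul, dotProduct_smul, hu, hv, ← hρ,
      dotProduct_comm v u, ← hρ]
    simp only [smul_eq_mul]
    field_simp
    rw [hs2]
    ring
  have hmap := map_discProj_prod hu hww huw
  rw [← lintegral_ofReal_tent hk hs (by rw [hs2]; ring), ← hmap, lintegral_map]
  · refine lintegral_congr fun g => ?_
    rw [cos_discAngle_sub]
    conv_lhs => rw [hvw, discProj_add_smul]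
  · exact ENNReal.measurable_ofReal.comp (((continuous_tent k).comp
      Real.continuous_arccos).measurable.comp
        (measurable_cos_arg_sub_arg (by fun_prop) (by fun_prop)))
  · exact (measurable_discProj u).prodMk (measurable_discProj w)

instance isProbabilityMeasure_roundingMeasure (n : ℕ) :
    IsProbabilityMeasure (roundingMeasure n) := by
  unfold roundingMeasure
  infer_instance

theorem measurable_discRounding (k : ℕ) {n : ℕ} (v : Fin n → Fin n → ℝ) (i : Fin n) :
    Measurable fun ω => discRounding k v ω i := by
  have h : Measurable fun ω : (Fin n ⊕ Fin n → ℝ) × ℝ => discAngle (v i) ω.1 :=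
    (measurable_discAngle (v i)).comp measurable_fst
  unfold discRounding
  exact measurable_arc k measurable_snd h

theorem integrable_separated (k : ℕ) {n : ℕ} (v : Fin n → Fin n → ℝ) (i j : Fin n) :
    Integrable (fun ω => if discRounding k v ω i ≠ discRounding k v ω j then (1 : ℝ) else 0)
      (roundingMeasure n) := by
  refine Integrable.of_bound (Measurable.aestronglyMeasurable ?_) 1
    (ae_of_all _ fun ω => by split_ifs <;> simp)
  exact Measurable.ite (measurableSet_eq_fun (measurable_discRounding k v i)
    (measurable_discRounding k v j)).compl measurable_const measurable_const

theorem integral_separated {k n : ℕ} (hk : 3 ≤ k) {v : Fin n → Fin n → ℝ} {i j : Fin n}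
    (hi : v i ⬝ᵥ v i = 1) (hj : v j ⬝ᵥ v j = 1) (h₁ : -1 < v i ⬝ᵥ v j) (h₂ : v i ⬝ᵥ v j < 1) :
    ∫ ω, (if discRounding k v ω i ≠ discRounding k v ω j then (1 : ℝ) else 0)
      ∂(roundingMeasure n) = separationProb k (v i ⬝ᵥ v j) := by
  have hint := integrable_separated k v i j
  rw [roundingMeasure] at hint ⊢
  rw [integral_prod _ hint]
  have hinner : ∀ g : Fin n ⊕ Fin n → ℝ,
      ∫ ψ, (if discRounding k v (g, ψ) i ≠ discRounding k v (g, ψ) j then (1 : ℝ) else 0)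
        ∂(cond volume (Set.Ico 0 (2 * π))) =
      1 - tent k (Real.arccos (Real.cos (discAngle (v j) g - discAngle (v i) g))) :=
    fun g => integral_cond_arc_ne hk (discAngle (v i) g) (discAngle (v j) g)
  simp_rw [hinner]
  have hm : Measurable fun g => tent k (Real.arccos (Real.cos
      (discAngle (v j) g - discAngle (v i) g))) :=
    ((continuous_tent k).comp (Real.continuous_arccos.comp Real.continuous_cos)).measurable.comp
      ((measurable_discAngle _).sub (measurable_discAngle _))
  have hti : Integrable (fun g => tent k (Real.arccos (Real.cos
      (discAngle (v j) g - discAngle (v i) g))))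
      (Measure.pi fun _ : Fin n ⊕ Fin n => gaussianReal 0 1) :=
    Integrable.of_bound hm.aestronglyMeasurable 1 (ae_of_all _ fun g => by
      rw [Real.norm_of_nonneg (tent_nonneg _ _)]
      exact tent_le_one (Real.arccos_nonneg _))
  rw [integral_sub (integrable_const _) hti, integral_eq_lintegral_of_nonneg_ae
    (ae_of_all _ fun g => tent_nonneg _ _) hm.aestronglyMeasurable,
    lintegral_tent_discAngle hk hi hj h₁ h₂]
  rw [ENNReal.toReal_ofReal]
  · simp
  · exact sub_nonneg.2 (separationProb_le_one hk h₁ h₂)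

end
end MaxKCut

/-! ### The edgewise bound, the relaxation, and the tight instance. -/

namespace MaxKCut
noncomputable section

open MeasureTheory

theorem expectedCut_eq_sum (k : ℕ) {n : ℕ} (G : WeightedGraph n) (v : Fin n → Fin n → ℝ) :
    expectedCut k G v = ∑ e ∈ G.edges, G.weight e.1 e.2 *
      ∫ ω, (if discRounding k v ω e.1 ≠ discRounding k v ω e.2 then (1 : ℝ) else 0)
        ∂(roundingMeasure n) := by
  have h : ∀ ω, cutWeight G (discRounding k v ω) = ∑ e ∈ G.edges, G.weight e.1 e.2 *
      if discRounding k v ω e.1 ≠ discRounding k v ω e.2 then (1 : ℝ) else 0 := by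
    intro ω
    refine Finset.sum_congr rfl fun e _ => ?_
    by_cases h : discRounding k v ω e.1 = discRounding k v ω e.2 <;> simp [h]
  simp only [expectedCut, h]
  rw [integral_finsetSum _ fun e _ => (integrable_separated k v e.1 e.2).const_mul _]
  simp only [integral_const_mul]

theorem expectedCut_nonneg (k : ℕ) {n : ℕ} (G : WeightedGraph n) (v : Fin n → Fin n → ℝ) :
    0 ≤ expectedCut k G v := by
  rw [expectedCut_eq_sum]
  exact Finset.sum_nonneg fun e _ => mul_nonneg (G.weight_nonneg _ _)
    (integral_nonneg fun ω => by positivity)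

theorem neg_one_lt_neg_one_div {k : ℕ} (hk : 3 ≤ k) : -1 < -1 / ((k : ℝ) - 1) := by
  have hk3 : (3 : ℝ) ≤ k := by exact_mod_cast hk
  rw [lt_div_iff₀ (by linarith)]
  linarith

theorem neg_one_div_lt_one {k : ℕ} (hk : 3 ≤ k) : -1 / ((k : ℝ) - 1) < 1 := by
  have hk3 : (3 : ℝ) ≤ k := by exact_mod_cast hk
  rw [div_lt_iff₀ (by linarith)]
  linarith

theorem phi_mul_le_integral_separated {k n : ℕ} (hk : 3 ≤ k) {v : Fin n → Fin n → ℝ}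
    (hv : IsFeasible k v) (i j : Fin n) :
    phi k * ((1 - v i ⬝ᵥ v j) * (((k : ℝ) - 1) / k)) ≤
      ∫ ω, (if discRounding k v ω i ≠ discRounding k v ω j then (1 : ℝ) else 0)
        ∂(roundingMeasure n) := by
  have hle : v i ⬝ᵥ v j ≤ 1 := by
    have h : 0 ≤ (v i - v j) ⬝ᵥ (v i - v j) := by
      simpa using dotProduct_star_self_nonneg (v i - v j)
    rw [sub_dotProduct, dotProduct_sub, dotProduct_sub, hv.1 i, hv.1 j,
      dotProduct_comm (v j) (v i)] at h
    linarith
  -- For coinciding vectors the angle has no density, but the lower bound is then zero. Antipodal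
  -- vectors are infeasible since `k ≥ 3`.
  rcases hle.eq_or_lt with h | h
  · rw [h, sub_self, zero_mul, mul_zero]
    exact integral_nonneg fun ω => by positivity
  · rw [integral_separated hk (hv.1 i) (hv.1 j) ((neg_one_lt_neg_one_div hk).trans_le (hv.2 i j)) h]
    exact phi_mul_le_separationProb hk (hv.2 i j) hle

theorem phi_mul_sdpValue_le_expectedCut {k n : ℕ} (hk : 3 ≤ k) (G : WeightedGraph n)
    {v : Fin n → Fin n → ℝ} (hv : IsFeasible k v) :
    phi k * sdpValue k G v ≤ expectedCut k G v := by
  rw [expectedCut_eq_sum, sdpValue, Finset.mul_sum]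
  refine Finset.sum_le_sum fun e _ => ?_
  calc phi k * (G.weight e.1 e.2 * (1 - v e.1 ⬝ᵥ v e.2) * (((k : ℝ) - 1) / k))
      = G.weight e.1 e.2 * (phi k * ((1 - v e.1 ⬝ᵥ v e.2) * (((k : ℝ) - 1) / k))) := by ring
    _ ≤ _ := mul_le_mul_of_nonneg_left (phi_mul_le_integral_separated hk hv _ _)
      (G.weight_nonneg _ _)

open scoped MatrixOrder Matrix.Norms.L2Operator in
/-- Every labelling comes from a feasible solution: send each label to a vertex of a regular
simplex. -/
theorem exists_feasible_dotProduct {k n : ℕ} (hk : 2 ≤ k) (c : Fin n → Fin k) :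
    ∃ u : Fin n → Fin n → ℝ, ∀ i j,
      u i ⬝ᵥ u j = if c i = c j then 1 else -1 / ((k : ℝ) - 1) := by
  have hk2 : (2 : ℝ) ≤ k := by exact_mod_cast hk
  have hk1 : 0 < (k : ℝ) - 1 := by linarith
  -- The columns are standard basis vectors of `ℝᵏ` minus their barycentre, scaled to unit length.
  set A : Matrix (Fin k) (Fin n) ℝ :=
    Matrix.of fun l i => √(k / (k - 1)) * ((if l = c i then 1 else 0) - 1 / k) with hA
  -- The simplex lives in `ℝᵏ`, but a solution needs vectors in `ℝⁿ`; factoring the `n × n` Gram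
  -- matrix supplies them with the same inner products.
  obtain ⟨B, hB⟩ := CStarAlgebra.nonneg_iff_eq_star_mul_self.1
    (Matrix.posSemidef_conjTranspose_mul_self A).nonneg
  refine ⟨fun i l => B l i, fun i j => ?_⟩
  have h1 : (fun l => B l i) ⬝ᵥ (fun l => B l j) = (A.conjTranspose * A) i j := by
    rw [hB]
    simp [Matrix.mul_apply, dotProduct]
  rw [h1, Matrix.mul_apply]
  have hs : √((k : ℝ) / (k - 1)) ^ 2 = k / (k - 1) := Real.sq_sqrt (by positivity)
  have h2 : ∀ l, A.conjTranspose i l * A l j = (k : ℝ) / (k - 1) *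
      ((if l = c i then (if l = c j then 1 else 0) else 0) - (if l = c i then 1 else 0) / k -
        (if l = c j then 1 else 0) / k + 1 / k ^ 2) := by
    intro l
    rw [← hs]
    simp only [hA, Matrix.conjTranspose_apply, Matrix.of_apply, star_trivial]
    split_ifs <;> ring
  simp only [h2, ← Finset.mul_sum, Finset.sum_add_distrib, Finset.sum_sub_distrib,
    ← Finset.sum_div, Finset.sum_ite_eq', Finset.mem_univ, if_true, Finset.sum_const,
    Finset.card_univ, Fintype.card_fin, nsmul_eq_mul]
  split_ifs <;> field_simp <;> ring

/-- The simplex solution of a labelling has relaxation value equal to the weight of its cut. -/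
theorem cutWeight_le_sdpValue {k n : ℕ} (hk : 3 ≤ k) {G : WeightedGraph n}
    {v : Fin n → Fin n → ℝ} (hv : IsOptimal k G v) (c : Fin n → Fin k) :
    cutWeight G c ≤ sdpValue k G v := by
  have hk3 : (3 : ℝ) ≤ k := by exact_mod_cast hk
  have hk1 : 0 < (k : ℝ) - 1 := by linarith
  obtain ⟨u, hu⟩ := exists_feasible_dotProduct (by omega) c
  have hfeas : IsFeasible k u := by
    refine ⟨fun i => by simp [hu], fun i j => ?_⟩
    rw [hu]
    split_ifs
    · exact (neg_one_div_lt_one hk).le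
    · exact le_rfl
  refine le_trans (le_of_eq ?_) (hv.2 u hfeas)
  refine Finset.sum_congr rfl fun e _ => ?_
  rw [hu]
  by_cases h : c e.1 = c e.2
  · simp [h]
  · simp only [h, ne_eq, not_false_eq_true, if_true, if_false]
    field_simp
    ring

theorem maxCut_le_sdpValue {k n : ℕ} (hk : 3 ≤ k) {G : WeightedGraph n}
    {v : Fin n → Fin n → ℝ} (hv : IsOptimal k G v) : maxCut k G ≤ sdpValue k G v := by
  have : Nonempty (Fin k) := ⟨⟨0, by omega⟩⟩
  exact ciSup_le fun c => cutWeight_le_sdpValue hk hv c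

/-- A single edge of weight one. -/
def singleEdge : WeightedGraph 2 where
  graph := ⊤
  weight _ _ := 1
  weight_symm _ _ := rfl
  weight_nonneg _ _ := zero_le_one

theorem singleEdge_edges : singleEdge.edges = {((0 : Fin 2), (1 : Fin 2))} := by
  ext ⟨i, j⟩
  fin_cases i <;> fin_cases j <;> simp [WeightedGraph.edges, singleEdge]

/-- Two unit vectors in the plane with inner product `ρ`. -/
def planePair (ρ : ℝ) : Fin 2 → Fin 2 → ℝ := ![![1, 0], ![ρ, √(1 - ρ ^ 2)]]

theorem planePair_dotProduct {ρ : ℝ} (h₁ : -1 < ρ) (h₂ : ρ < 1) (i j : Fin 2) :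
    planePair ρ i ⬝ᵥ planePair ρ j = if i = j then 1 else ρ := by
  have hs : √(1 - ρ ^ 2) * √(1 - ρ ^ 2) = 1 - ρ ^ 2 := Real.mul_self_sqrt (by nlinarith)
  fin_cases i <;> fin_cases j <;> simp [planePair, dotProduct, Fin.sum_univ_two, hs]
  ring

theorem isOptimal_planePair {k : ℕ} (hk : 3 ≤ k) :
    IsOptimal k singleEdge (planePair (-1 / ((k : ℝ) - 1))) ∧
      sdpValue k singleEdge (planePair (-1 / ((k : ℝ) - 1))) = 1 := by
  have hk3 : (3 : ℝ) ≤ k := by exact_mod_cast hk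
  have hk1 : 0 < (k : ℝ) - 1 := by linarith
  have hd := planePair_dotProduct (neg_one_lt_neg_one_div hk) (neg_one_div_lt_one hk)
  have hval : sdpValue k singleEdge (planePair (-1 / ((k : ℝ) - 1))) = 1 := by
    rw [sdpValue, singleEdge_edges, Finset.sum_singleton, hd]
    simp only [singleEdge, zero_ne_one, if_false]
    field_simp
    ring
  refine ⟨⟨⟨fun i => by simp [hd], fun i j => ?_⟩, fun u hu => ?_⟩, hval⟩
  · rw [hd]
    split_ifs
    · exact (neg_one_div_lt_one hk).le
    · exact le_rfl
  · rw [hval, sdpValue, singleEdge_edges, Finset.sum_singleton]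
    have h := hu.2 0 1
    rw [div_le_iff₀ hk1] at h
    simp only [singleEdge]
    rw [one_mul, ← mul_div_assoc, div_le_one (by linarith)]
    linarith

theorem maxCut_singleEdge {k : ℕ} (hk : 3 ≤ k) : maxCut k singleEdge = 1 := by
  refine le_antisymm ?_ ?_
  · rw [← (isOptimal_planePair hk).2]
    exact maxCut_le_sdpValue hk (isOptimal_planePair hk).1
  · have h := le_ciSup (Set.finite_range fun c : Fin 2 → Fin k => cutWeight singleEdge c).bddAbove
      ![⟨0, by omega⟩, ⟨1, by omega⟩]
    refine le_trans (le_of_eq ?_) h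
    rw [cutWeight, singleEdge_edges, Finset.sum_singleton]
    simp [singleEdge]

theorem expectedCut_planePair {k : ℕ} (hk : 3 ≤ k) :
    expectedCut k singleEdge (planePair (-1 / ((k : ℝ) - 1))) = phi k := by
  have hd := planePair_dotProduct (neg_one_lt_neg_one_div hk) (neg_one_div_lt_one hk)
  have h01 : planePair (-1 / ((k : ℝ) - 1)) 0 ⬝ᵥ planePair (-1 / ((k : ℝ) - 1)) 1 =
      -1 / ((k : ℝ) - 1) := by simp [hd]
  rw [expectedCut_eq_sum, singleEdge_edges, Finset.sum_singleton,
    integral_separated hk (by simp [hd]) (by simp [hd])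
      (by rw [h01]; exact neg_one_lt_neg_one_div hk) (by rw [h01]; exact neg_one_div_lt_one hk),
    h01, separationProb_eq_phi]
  simp [singleEdge]

/-- The constant is itself the expected weight of a cut. Its sign is what allows `maxCut` to be
replaced by the larger relaxation value in the ratio bound. -/
theorem phi_nonneg {k : ℕ} (hk : 3 ≤ k) : 0 ≤ phi k := by
  rw [← expectedCut_planePair hk]
  exact expectedCut_nonneg _ _ _

end

end MaxKCut

theorem mainTheorem1 (k : ℕ) (hk : 3 ≤ k) :
    IsLeast (MaxKCut.approximationRatios k) (MaxKCut.phi k) ∧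
      ∀ (n : ℕ) (G : MaxKCut.WeightedGraph n) (v : Fin n → Fin n → ℝ),
        MaxKCut.IsFeasible k v →
          MaxKCut.phi k * MaxKCut.sdpValue k G v ≤ MaxKCut.expectedCut k G v := by
  refine ⟨⟨⟨2, MaxKCut.singleEdge, MaxKCut.planePair (-1 / ((k : ℝ) - 1)),
    (MaxKCut.isOptimal_planePair hk).1, ?_, ?_⟩, ?_⟩,
    fun n G v hv => MaxKCut.phi_mul_sdpValue_le_expectedCut hk G hv⟩
  · rw [MaxKCut.maxCut_singleEdge hk]
    exact one_pos
  · rw [MaxKCut.expectedCut_planePair hk, MaxKCut.maxCut_singleEdge hk, div_one]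
  · rintro ρ ⟨n, G, v, hv, hpos, rfl⟩
    rw [le_div_iff₀ hpos]
    exact (mul_le_mul_of_nonneg_left (MaxKCut.maxCut_le_sdpValue hk hv)
      (MaxKCut.phi_nonneg hk)).trans (MaxKCut.phi_mul_sdpValue_le_expectedCut hk G hv.1)
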